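/- Let $n\ge 2$, $B_r=\{x\in\mathbb R^n: |x|<r\}$, $0<\lambda\le\Lambda$ and $\overline L\in\mathbb R$. Then there is a constant $C>0$, depending only on $n,\lambda,\Lambda,\overline L$, such that the following holds. Let $A=(a_{ij})_{i,j=1}^n$ be a (not necessarily symmetric) real matrix field on $B_1$ that is uniformly elliptic, $$\lambda|\xi|^2\le A(x)\xi\cdot\xi\le\Lambda|\xi|^2\qquad\text{for all }x\in B_1,\ \xi\in\mathbb R^n,$$ and Lipschitz with $\|A\|_{C^{0,1}(B_1)}\le\overline L$, where $$\|A\|_{C^{0,1}(B_1)}=\max_{i,j}\Big(\sup_{B_1}|a_{ij}|+\sup_{x\ne y\in B_1}\frac{|a_{ij}(x)-a_{ij}(y)|}{|x-y|}\Big).$$ Let $F\in H^1(B_1;\mathbb R^n)$, and let $u\in H^1(B_1)$ be a weak solution of $-\mathrm{div}(A\nabla u)=\mathrm{div}\,F$ in $B_1$, that is, $$\int_{B_1}A\nabla u\cdot\nabla\phi=-\int_{B_1}F\cdot\nabla\phi\qquad\text{for all }\phi\in C_c^\infty(B_1).$$ Then $u\in H^2(B_{1/2})$ and $$\|u\|_{H^2(B_{1/2})}\le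 C\big(\|u\|_{L^2(B_1)}+\|F\|_{H^1(B_1)}\big).$$ -/

import Mathlib

open MeasureTheory Set Metric
open scoped ENNReal NNReal Matrix ContDiff

noncomputable section

namespace DivForm

/-- `φ ∈ C_c^∞(Ω)`. -/
structure IsTestFn {n : ℕ} (Ω : Set (EuclideanSpace ℝ (Fin n)))
    (φ : EuclideanSpace ℝ (Fin n) → ℝ) : Prop where
  contDiff : ContDiff ℝ ∞ φ
  hasCompactSupport : HasCompactSupport φ
  tsupport_subset : tsupport φ ⊆ Ω

/-- The classical partial derivative `∂_i φ (x)`. -/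
def partialD {n : ℕ} (i : Fin n) (φ : EuclideanSpace ℝ (Fin n) → ℝ)
    (x : EuclideanSpace ℝ (Fin n)) : ℝ :=
  fderiv ℝ φ x (EuclideanSpace.single i 1)

/-- `g` is a weak `i`-th partial derivative of `u` in `Ω`. -/
structure HasWeakPartial {n : ℕ} (Ω : Set (EuclideanSpace ℝ (Fin n))) (i : Fin n)
    (u g : EuclideanSpace ℝ (Fin n) → ℝ) : Prop where
  locallyIntegrableOn : LocallyIntegrableOn u Ω volume
  locallyIntegrableOn_deriv : LocallyIntegrableOn g Ω volume
  integral_eq : ∀ φ, IsTestFn Ω φ →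
    ∫ x in Ω, u x * partialD i φ x = - ∫ x in Ω, g x * φ x

open Classical in
/-- The weak `i`-th partial derivative of `u` in `Ω` (well defined almost everywhere in an open
set `Ω`, see `HasWeakPartial.ae_eq`), and `0` if there is none. -/
def weakPartial {n : ℕ} (Ω : Set (EuclideanSpace ℝ (Fin n))) (i : Fin n)
    (u : EuclideanSpace ℝ (Fin n) → ℝ) : EuclideanSpace ℝ (Fin n) → ℝ :=
  if h : ∃ g, HasWeakPartial Ω i u g then h.choose else 0

theorem hasWeakPartial_weakPartial {n : ℕ} {Ω : Set (EuclideanSpace ℝ (Fin n))} {i : Fin n}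
    {u : EuclideanSpace ℝ (Fin n) → ℝ} (h : ∃ g, HasWeakPartial Ω i u g) :
    HasWeakPartial Ω i u (weakPartial Ω i u) := by
  rw [weakPartial, dif_pos h]
  exact h.choose_spec

/-- `u ∈ L²(Ω)`. -/
def MemL2 {n : ℕ} (Ω : Set (EuclideanSpace ℝ (Fin n)))
    (u : EuclideanSpace ℝ (Fin n) → ℝ) : Prop :=
  MemLp u 2 (volume.restrict Ω)

/-- `u ∈ H¹(Ω)`: `u` and its weak first partial derivatives are in `L²(Ω)`. -/
def MemH1 {n : ℕ} (Ω : Set (EuclideanSpace ℝ (Fin n)))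
    (u : EuclideanSpace ℝ (Fin n) → ℝ) : Prop :=
  MemL2 Ω u ∧ ∀ i, ∃ g, HasWeakPartial Ω i u g ∧ MemL2 Ω g

/-- `u ∈ H²(Ω)`: `u` and its weak partial derivatives of first and second order are
in `L²(Ω)`. -/
def MemH2 {n : ℕ} (Ω : Set (EuclideanSpace ℝ (Fin n)))
    (u : EuclideanSpace ℝ (Fin n) → ℝ) : Prop :=
  MemL2 Ω u ∧ ∀ i, ∃ g, HasWeakPartial Ω i u g ∧ MemH1 Ω g

/-- `‖u‖_{L²(Ω)}`. -/
def normL2 {n : ℕ} (Ω : Set (EuclideanSpace ℝ (Fin n)))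
    (u : EuclideanSpace ℝ (Fin n) → ℝ) : ℝ :=
  (eLpNorm u 2 (volume.restrict Ω)).toReal

/-- `‖u‖_{H¹(Ω)}`, for `u ∈ H¹(Ω)`. -/
def normH1 {n : ℕ} (Ω : Set (EuclideanSpace ℝ (Fin n)))
    (u : EuclideanSpace ℝ (Fin n) → ℝ) : ℝ :=
  √(normL2 Ω u ^ 2 + ∑ i, normL2 Ω (weakPartial Ω i u) ^ 2)

/-- `‖u‖_{H²(Ω)}`, for `u ∈ H²(Ω)`. -/
def normH2 {n : ℕ} (Ω : Set (EuclideanSpace ℝ (Fin n)))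
    (u : EuclideanSpace ℝ (Fin n) → ℝ) : ℝ :=
  √(normL2 Ω u ^ 2 + ∑ i, normL2 Ω (weakPartial Ω i u) ^ 2
    + ∑ i, ∑ j, normL2 Ω (weakPartial Ω j (weakPartial Ω i u)) ^ 2)

/-- `F ∈ H¹(Ω)` for a vector field `F`. -/
def FieldMemH1 {n : ℕ} (Ω : Set (EuclideanSpace ℝ (Fin n)))
    (F : EuclideanSpace ℝ (Fin n) → Fin n → ℝ) : Prop :=
  ∀ i, MemH1 Ω (fun x => F x i)

/-- `‖F‖_{H¹(Ω)}` for a vector field `F`. -/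
def fieldNormH1 {n : ℕ} (Ω : Set (EuclideanSpace ℝ (Fin n)))
    (F : EuclideanSpace ℝ (Fin n) → Fin n → ℝ) : ℝ :=
  √(∑ i, normH1 Ω (fun x => F x i) ^ 2)

/-- `‖a‖_{C^{0,1}(Ω)} = sup_Ω |a| + [a]_{C^{0,1}(Ω)}`, which is finite exactly if
`a ∈ C^{0,1}(Ω)`. -/
def eNormC01 {n : ℕ} (Ω : Set (EuclideanSpace ℝ (Fin n)))
    (a : EuclideanSpace ℝ (Fin n) → ℝ) : ℝ≥0∞ :=
  (⨆ x ∈ Ω, ‖a x‖ₑ) + ⨆ x ∈ Ω, ⨆ y ∈ Ω, ⨆ _ : x ≠ y, edist (a x) (a y) / edist x y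

/-- The `C^{0,1}(Ω)`-norm of a matrix field: the largest one among its entries. -/
def matrixENormC01 {n : ℕ} (Ω : Set (EuclideanSpace ℝ (Fin n)))
    (A : EuclideanSpace ℝ (Fin n) → Matrix (Fin n) (Fin n) ℝ) : ℝ≥0∞ :=
  ⨆ i, ⨆ j, eNormC01 Ω (fun x => A x i j)

/-- `lam |ξ|² ≤ A(x) ξ · ξ ≤ Lam |ξ|²` for all `x ∈ Ω` and `ξ ∈ ℝⁿ`. -/
def UniformlyElliptic {n : ℕ} (Ω : Set (EuclideanSpace ℝ (Fin n))) (lam Lam : ℝ)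
    (A : EuclideanSpace ℝ (Fin n) → Matrix (Fin n) (Fin n) ℝ) : Prop :=
  ∀ x ∈ Ω, ∀ ξ : Fin n → ℝ,
    lam * (ξ ⬝ᵥ ξ) ≤ (A x *ᵥ ξ) ⬝ᵥ ξ ∧ (A x *ᵥ ξ) ⬝ᵥ ξ ≤ Lam * (ξ ⬝ᵥ ξ)

/-- `u ∈ H¹(Ω)` is a weak solution of `-div(A ∇u) = div F` in `Ω`:
`∫_Ω A ∇u · ∇φ = - ∫_Ω F · ∇φ` for every `φ ∈ C_c^∞(Ω)`. -/
structure IsWeakSolution {n : ℕ} (Ω : Set (EuclideanSpace ℝ (Fin n)))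
    (A : EuclideanSpace ℝ (Fin n) → Matrix (Fin n) (Fin n) ℝ)
    (F : EuclideanSpace ℝ (Fin n) → Fin n → ℝ)
    (u : EuclideanSpace ℝ (Fin n) → ℝ) : Prop where
  memH1 : MemH1 Ω u
  integral_eq : ∀ φ, IsTestFn Ω φ →
    ∫ x in Ω, (A x *ᵥ fun i => weakPartial Ω i u x) ⬝ᵥ (fun i => partialD i φ x)
      = - ∫ x in Ω, F x ⬝ᵥ (fun i => partialD i φ x)

/-- Weak partial derivatives in an open set are unique up to null sets. -/
theorem HasWeakPartial.ae_eq {n : ℕ} {Ω : Set (EuclideanSpace ℝ (Fin n))} (hΩ : IsOpen Ω)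
    {i : Fin n} {u g g' : EuclideanSpace ℝ (Fin n) → ℝ}
    (h : HasWeakPartial Ω i u g) (h' : HasWeakPartial Ω i u g') :
    g =ᵐ[volume.restrict Ω] g' := by
  have key := hΩ.ae_eq_zero_of_integral_contDiff_smul_eq_zero (μ := volume) (f := g - g')
    (h.locallyIntegrableOn_deriv.sub h'.locallyIntegrableOn_deriv) ?_
  · rw [Filter.EventuallyEq, ae_restrict_iff' hΩ.measurableSet]
    filter_upwards [key] with x hx hxΩ
    exact sub_eq_zero.mp (hx hxΩ)
  · intro φ hφ hc hs
    have int : ∀ f : EuclideanSpace ℝ (Fin n) → ℝ, LocallyIntegrableOn f Ω volume →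
        Integrable (fun x => f x * φ x) (volume.restrict Ω) := by
      intro f hf
      have h1 : IntegrableOn (fun x => f x * φ x) (tsupport φ) volume :=
        (hf.integrableOn_compact_subset hs hc).mul_continuousOn hφ.continuous.continuousOn hc
      have h2 : Integrable (fun x => f x * φ x) volume := by
        refine (integrableOn_iff_integrable_of_support_subset ?_).mp h1
        exact (Function.support_mul_subset_right f φ).trans (subset_tsupport φ)
      exact h2.integrableOn
    have e := h.integral_eq φ ⟨hφ, hc, hs⟩
    rw [h'.integral_eq φ ⟨hφ, hc, hs⟩, neg_inj] at e
    have hset : ∫ x, φ x • (g - g') x = ∫ x in Ω, φ x • (g - g') x := by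
      refine (setIntegral_eq_integral_of_forall_compl_eq_zero ?_).symm
      intro x hx
      rw [image_eq_zero_of_notMem_tsupport (fun hx' => hx (hs hx')), zero_smul]
    rw [hset]
    calc ∫ x in Ω, φ x • (g - g') x = ∫ x in Ω, (g x * φ x - g' x * φ x) := by
          congr 1
          funext x
          simp only [Pi.sub_apply, smul_eq_mul]
          ring
      _ = 0 := by
          rw [integral_sub (int g h.locallyIntegrableOn_deriv)
            (int g' h'.locallyIntegrableOn_deriv), e, sub_self]

end DivForm

end

open DivForm

/-!
Interior `H²` regularity is proved by mollification, without difference quotients.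

Let `g = ∇u` and `h = A g + F`, so that `h` is divergence free in the sense of distributions. Let
`κ` be a smooth kernel supported in a small ball around the origin, and let `v = κ * u` and
`H = κ * h`. Away from the boundary, `H` is smooth and divergence free in the classical sense, since
`κ (x - ·)` is a test function, and `∇v = κ * g`. Moreover `H = A ∇v + R + κ * F`, where
`R x = ∫ κ (x - y) (A y - A x) g y dy`. As `A` is Lipschitz, `|R|` is at most a constant times the
convolution of `|z| |κ z|` with `|g|` (`conv_mul_sub_le`), so Young's inequality (`memLp_conv`)
bounds `‖R‖₂` by a multiple of `m(κ) ‖g‖₂` with `m(κ) = ∫ |z| |κ z| dz`. No derivative of `A` is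
involved. Testing `div H = 0` with `η² v` for a cutoff function `η` (`energy_le`) yields
`‖∇v‖² ≤ C (m(κ)² ‖∇u‖² + ‖κ * F‖² + ‖v‖²)`, the norm on the left being over a smaller ball
(`mollified_energy_le`, `exists_mollified_interior_le`).

This inequality is used for two kinds of kernels, where `ρ_δ` is a mollifier of scale `δ`.
* For `κ = ρ_δ` the moment `m(κ) ≤ δ` tends to zero, and the limit is Caccioppoli's inequality
  `‖∇u‖² ≤ C (‖u‖² + ‖F‖²)` on the ball of radius `3/4` (`exists_gradient_le`).
* For `κ = ∂_k ρ_δ` the moment is bounded independently of `δ` (`exists_isMollifier`), while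
  `v = ρ_δ * ∂_k u` and `κ * F = ρ_δ * ∂_k F`. Hence `∇(ρ_δ * ∂_k u)` is bounded in `L²` on the ball
  of radius `1/2` by `∇u` and `∂_k F` on the ball of radius `3/4` (`exists_hessian_le`).

Both limits are taken by duality: the Riesz representation theorem turns a bound on the derivatives
of a weakly convergent sequence into a weak derivative of the limit
(`exists_hasWeakPartial_of_tendsto`).
-/

namespace DivForm

/-! ### Convolutions and Young's inequality -/

/-- The convolution `x ↦ ∫ κ (x - y) f y` of a kernel `κ` with a function `f` on `ℝⁿ`. -/
noncomputable def conv {n : ℕ} (κ f : EuclideanSpace ℝ (Fin n) → ℝ) :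
    EuclideanSpace ℝ (Fin n) → ℝ :=
  convolution κ f (ContinuousLinearMap.mul ℝ ℝ) volume

section Conv

variable {n : ℕ} {κ f : EuclideanSpace ℝ (Fin n) → ℝ}

theorem conv_apply (κ f : EuclideanSpace ℝ (Fin n) → ℝ) (x : EuclideanSpace ℝ (Fin n)) :
    conv κ f x = ∫ y, κ (x - y) * f y := by
  simp [conv, convolution_eq_swap]

theorem conv_contDiff (hκ : ContDiff ℝ ∞ κ) (hc : HasCompactSupport κ)
    (hf : LocallyIntegrable f volume) : ContDiff ℝ ∞ (conv κ f) :=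
  hc.contDiff_convolution_left _ hκ hf

theorem partialD_conv (hκ : ContDiff ℝ ∞ κ) (hc : HasCompactSupport κ)
    (hf : LocallyIntegrable f volume) (i : Fin n) :
    partialD i (conv κ f) = conv (partialD i κ) f := by
  funext x
  have hκ1 : ContDiff ℝ 1 κ := hκ.of_le (by exact_mod_cast le_top)
  have h := hc.hasFDerivAt_convolution_left (ContinuousLinearMap.mul ℝ ℝ) hκ1 hf x
  rw [partialD, conv, h.fderiv, conv_apply, convolution_eq_swap,
    ContinuousLinearMap.integral_apply]
  · simp [partialD, ContinuousLinearMap.precompL, mul_comm]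
  · have := (hc.fderiv (𝕜 := ℝ)).convolutionExists_left
      ((ContinuousLinearMap.mul ℝ ℝ).precompL (EuclideanSpace ℝ (Fin n)))
      (hκ1.continuous_fderiv one_ne_zero) hf x
    exact this.integrable_swap

theorem partialD_contDiff (hκ : ContDiff ℝ ∞ κ) (i : Fin n) : ContDiff ℝ ∞ (partialD i κ) :=
  (hκ.fderiv_right (m := ∞) (by simp)).clm_apply contDiff_const

theorem tsupport_partialD_subset (κ : EuclideanSpace ℝ (Fin n) → ℝ) (i : Fin n) :
    tsupport (partialD i κ) ⊆ tsupport κ := by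
  refine (closure_mono ?_).trans (tsupport_fderiv_subset ℝ (f := κ))
  intro x hx h
  apply hx
  simp [partialD, h]

theorem hasCompactSupport_partialD (hc : HasCompactSupport κ) (i : Fin n) :
    HasCompactSupport (partialD i κ) :=
  hc.of_isClosed_subset (isClosed_tsupport _) (tsupport_partialD_subset κ i)

theorem integrable_conv_integrand (hκ : Continuous κ) (hc : HasCompactSupport κ)
    (hf : LocallyIntegrable f volume) (x : EuclideanSpace ℝ (Fin n)) :
    Integrable (fun y => κ (x - y) * f y) volume := by
  simpa using (hc.convolutionExists_left (ContinuousLinearMap.mul ℝ ℝ) hκ hf x).integrable_swap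

/-- Cauchy-Schwarz inequality for the measure `|κ (x - y)| dy`. -/
theorem conv_sq_le (hκ : Continuous κ) (hc : HasCompactSupport κ)
    (hf : MemLp f 2 volume) (x : EuclideanSpace ℝ (Fin n)) :
    conv κ f x ^ 2 ≤ (∫ z, |κ z|) * conv (fun z => |κ z|) (fun y => f y ^ 2) x := by
  have hκ' : Continuous fun z => |κ z| := hκ.abs
  have hc' : HasCompactSupport fun z => |κ z| := hc.comp_left abs_zero
  have i1 := integrable_conv_integrand hκ' hc' (f := fun y => |f y|)
    (hf.norm.locallyIntegrable (by norm_num)) x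
  have i2 := integrable_conv_integrand hκ' hc' (f := fun y => f y ^ 2)
    hf.integrable_sq.locallyIntegrable x
  have i0 := integrable_conv_integrand hκ' hc' (f := fun _ => 1) (locallyIntegrable_const 1) x
  set Q := ∫ y, |κ (x - y)| * |f y| with hQ
  have hK : ∫ y, |κ (x - y)| * 1 = ∫ z, |κ z| := by
    simp only [mul_one]
    exact integral_sub_left_eq_self (fun z => |κ z|) volume x
  have h1 : |conv κ f x| ≤ Q := by
    rw [conv_apply]
    refine (abs_integral_le_integral_abs).trans (le_of_eq ?_)
    simp [hQ, abs_mul]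
  -- `∫ |κ (x - y)| (s - |f y|)² dy ≥ 0` for all `s`, so this quadratic has discriminant `≤ 0`.
  have h2 : ∀ s : ℝ, 0 ≤ (∫ z, |κ z|) * (s * s) + (-2 * Q) * s
      + conv (fun z => |κ z|) (fun y => f y ^ 2) x := by
    intro s
    have : 0 ≤ ∫ y, |κ (x - y)| * (s - |f y|) ^ 2 :=
      integral_nonneg fun y => by positivity
    refine this.trans (le_of_eq ?_)
    rw [← hK, conv_apply, hQ, ← integral_mul_const, ← integral_const_mul, ← integral_mul_const,
      ← integral_add (i0.mul_const _) ((i1.const_mul _).mul_const _),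
      ← integral_add _ i2]
    · congr 1
      funext y
      rw [sub_sq, sq_abs]
      ring
    · exact (i0.mul_const _).add ((i1.const_mul _).mul_const _)
  have h3 := discrim_le_zero h2
  have h4 : conv κ f x ^ 2 ≤ Q ^ 2 := by
    rw [← sq_abs]
    gcongr
  rw [discrim] at h3
  nlinarith

/-- Young's inequality `‖κ * f‖₂ ≤ ‖κ‖₁ ‖f‖₂`. -/
theorem memLp_conv (hκ : Continuous κ) (hc : HasCompactSupport κ)
    (hf : MemLp f 2 volume) :
    MemLp (conv κ f) 2 volume ∧ ∫ x, conv κ f x ^ 2 ≤ (∫ z, |κ z|) ^ 2 * ∫ y, f y ^ 2 := by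
  have hκ' : Continuous fun z => |κ z| := hκ.abs
  have hc' : HasCompactSupport fun z => |κ z| := hc.comp_left abs_zero
  have hfl : LocallyIntegrable f volume := hf.locallyIntegrable (by norm_num)
  have hK : Integrable (fun z => |κ z|) volume := hκ'.integrable_of_hasCompactSupport hc'
  have hI : Integrable (conv (fun z => |κ z|) (fun y => f y ^ 2)) volume :=
    hK.integrable_convolution _ hf.integrable_sq
  have hcont : Continuous (conv κ f) := hc.continuous_convolution_left _ hκ hfl
  have hsq : Integrable (fun x => conv κ f x ^ 2) volume := by
    refine (hI.const_mul (∫ z, |κ z|)).mono' (by fun_prop) (.of_forall fun x => ?_)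
    rw [Real.norm_of_nonneg (sq_nonneg _)]
    exact conv_sq_le hκ hc hf x
  refine ⟨(memLp_two_iff_integrable_sq hcont.aestronglyMeasurable).mpr hsq, ?_⟩
  calc ∫ x, conv κ f x ^ 2 ≤ ∫ x, (∫ z, |κ z|) * conv (fun z => |κ z|) (fun y => f y ^ 2) x :=
        integral_mono hsq (hI.const_mul _) fun x => conv_sq_le hκ hc hf x
    _ = _ := by
        rw [integral_const_mul, conv,
          integral_convolution (ContinuousLinearMap.mul ℝ ℝ) hK hf.integrable_sq]
        simp only [ContinuousLinearMap.mul_apply']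
        ring

end Conv

/-! ### Caccioppoli's inequality for smooth functions -/

section Energy

variable {n : ℕ}

theorem partialD_mul {f g : EuclideanSpace ℝ (Fin n) → ℝ} {x : EuclideanSpace ℝ (Fin n)}
    (hf : DifferentiableAt ℝ f x) (hg : DifferentiableAt ℝ g x) (i : Fin n) :
    partialD i (fun x => f x * g x) x = f x * partialD i g x + partialD i f x * g x := by
  simp only [partialD, fderiv_fun_mul hf hg]
  simp [mul_comm]

theorem partialD_eq_zero_of_notMem {f : EuclideanSpace ℝ (Fin n) → ℝ}
    {x : EuclideanSpace ℝ (Fin n)} (hx : x ∉ tsupport f) (i : Fin n) : partialD i f x = 0 :=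
  image_eq_zero_of_notMem_tsupport fun h => hx (tsupport_partialD_subset f i h)

theorem integral_mul_partialD {f ζ : EuclideanSpace ℝ (Fin n) → ℝ}
    (hf : ContDiff ℝ ∞ f) (hζ : ContDiff ℝ ∞ ζ) (hc : HasCompactSupport ζ) (i : Fin n) :
    ∫ x, f x * partialD i ζ x = - ∫ x, partialD i f x * ζ x := by
  have c1 : Continuous f := hf.continuous
  have c2 : Continuous ζ := hζ.continuous
  have c3 := (partialD_contDiff hf i).continuous
  have c4 := (partialD_contDiff hζ i).continuous
  refine integral_mul_fderiv_eq_neg_fderiv_mul_of_integrable ?_ ?_ ?_ ?_ ?_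
  · exact (c3.mul c2).integrable_of_hasCompactSupport hc.mul_left
  · exact (c1.mul c4).integrable_of_hasCompactSupport (hasCompactSupport_partialD hc i).mul_left
  · exact (c1.mul c2).integrable_of_hasCompactSupport hc.mul_left
  · exact fun x _ => hf.contDiffAt.differentiableAt (by simp)
  · exact fun x _ => hζ.contDiffAt.differentiableAt (by simp)

theorem sum_mulVec_sq_le (A : Matrix (Fin n) (Fin n) ℝ) {L : ℝ} (hA : ∀ i j, |A i j| ≤ L)
    (w : Fin n → ℝ) : ∑ i, (A *ᵥ w) i ^ 2 ≤ (n ^ 2 * L ^ 2) * ∑ i, w i ^ 2 := by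
  have h : ∀ i, (A *ᵥ w) i ^ 2 ≤ (n * L ^ 2) * ∑ i, w i ^ 2 := by
    intro i
    refine (Finset.sum_mul_sq_le_sq_mul_sq Finset.univ (A i) w).trans ?_
    gcongr
    calc ∑ j, A i j ^ 2 ≤ ∑ _j : Fin n, L ^ 2 :=
          Finset.sum_le_sum fun j _ => sq_le_sq' (abs_le.mp (hA i j)).1 (abs_le.mp (hA i j)).2
      _ = n * L ^ 2 := by simp
  calc _ ≤ ∑ _i : Fin n, (n * L ^ 2) * ∑ i, w i ^ 2 := Finset.sum_le_sum fun i _ => h i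
    _ = _ := by simp; ring

/-- The algebra behind the energy estimate: Young's inequality absorbs every term which is linear
in `w` into the coercive term `A w · w`. Here `w`, `G`, `e` stand for `∇v`, for the difference of
the flux and `A ∇v`, and for `∇η`. -/
theorem coercive_pointwise (A : Matrix (Fin n) (Fin n) ℝ) {lam L : ℝ} (hlam : 0 < lam)
    (hA : ∀ i j, |A i j| ≤ L) (w G e : Fin n → ℝ) (t v : ℝ)
    (hell : lam * (w ⬝ᵥ w) ≤ (A *ᵥ w) ⬝ᵥ w) :
    lam / 2 * (t ^ 2 * ∑ i, w i ^ 2) ≤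
      ∑ i, ((A *ᵥ w) i + G i) * (t ^ 2 * w i + 2 * t * v * e i)
      + (1 / lam + 1) * (t ^ 2 * ∑ i, G i ^ 2)
      + (4 * (n ^ 2 * L ^ 2 + 1) / lam + 1) * (v ^ 2 * ∑ i, e i ^ 2) := by
  set B : ℝ := n ^ 2 * L ^ 2 with hB
  have hB0 : 0 ≤ B := by positivity
  have hsum := sum_mulVec_sq_le A hA w
  rw [← hB] at hsum
  set a := A *ᵥ w with ha
  have hell' : lam * ∑ i, w i ^ 2 ≤ ∑ i, a i * w i := by
    simpa [dotProduct, sq] using hell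
  -- The weight `lam / (4 (B + 1))` in front of `a i ^ 2` is such that, by `∑ a i ^ 2 ≤ B ∑ w i ^ 2`,
  -- this term costs at most a quarter of the coercive one.
  have hterm : ∀ i, t ^ 2 * (a i * w i) - lam / 4 * t ^ 2 * w i ^ 2
      - lam / (4 * (B + 1)) * t ^ 2 * a i ^ 2 ≤
      (a i + G i) * (t ^ 2 * w i + 2 * t * v * e i) + (1 / lam + 1) * t ^ 2 * G i ^ 2
      + (4 * (B + 1) / lam + 1) * v ^ 2 * e i ^ 2 := by
    intro i
    have q1 : 0 ≤ lam / 4 * (t * w i + 2 / lam * (t * G i)) ^ 2 := by positivity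
    have q2 : 0 ≤ lam / (4 * (B + 1)) * (t * a i + 4 * (B + 1) / lam * (v * e i)) ^ 2 := by
      positivity
    have q3 : 0 ≤ (t * G i + v * e i) ^ 2 := by positivity
    have e1 : lam / 4 * (t * w i + 2 / lam * (t * G i)) ^ 2 =
        lam / 4 * t ^ 2 * w i ^ 2 + t ^ 2 * w i * G i + 1 / lam * t ^ 2 * G i ^ 2 := by
      field_simp; ring
    have e2 : lam / (4 * (B + 1)) * (t * a i + 4 * (B + 1) / lam * (v * e i)) ^ 2 =
        lam / (4 * (B + 1)) * t ^ 2 * a i ^ 2 + 2 * t * a i * v * e i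
          + 4 * (B + 1) / lam * v ^ 2 * e i ^ 2 := by
      have : B + 1 ≠ 0 := by positivity
      field_simp; ring
    rw [e1] at q1
    rw [e2] at q2
    linarith
  have hs := Finset.sum_le_sum fun i (_ : i ∈ Finset.univ) => hterm i
  simp only [Finset.sum_sub_distrib, Finset.sum_add_distrib, ← Finset.mul_sum] at hs
  have h1 : t ^ 2 * (lam * ∑ i, w i ^ 2) ≤ t ^ 2 * ∑ i, a i * w i := by gcongr
  have h2 : lam / (4 * (B + 1)) * t ^ 2 * ∑ i, a i ^ 2 ≤ lam / 4 * (t ^ 2 * ∑ i, w i ^ 2) := by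
    calc _ ≤ lam / (4 * (B + 1)) * t ^ 2 * (B * ∑ i, w i ^ 2) := by gcongr
      _ = (B / (B + 1)) * (lam / 4 * (t ^ 2 * ∑ i, w i ^ 2)) := by
          have : B + 1 ≠ 0 := by positivity
          field_simp
      _ ≤ 1 * (lam / 4 * (t ^ 2 * ∑ i, w i ^ 2)) := by
          gcongr
          rw [div_le_one (by positivity)]
          linarith
      _ = _ := one_mul _
  linarith

/-- Caccioppoli's inequality for a smooth function `v` and a smooth divergence free field `H`,
which is regarded as a perturbation of the flux `A ∇v`. -/
theorem energy_le {A : EuclideanSpace ℝ (Fin n) → Matrix (Fin n) (Fin n) ℝ}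
    {η v : EuclideanSpace ℝ (Fin n) → ℝ} {H : Fin n → EuclideanSpace ℝ (Fin n) → ℝ} {lam L : ℝ}
    (hlam : 0 < lam) (hAc : ∀ i j, Continuous fun x => A x i j)
    (hη : ContDiff ℝ ∞ η) (hc : HasCompactSupport η)
    (hell : ∀ x ∈ tsupport η, ∀ ξ : Fin n → ℝ, lam * (ξ ⬝ᵥ ξ) ≤ (A x *ᵥ ξ) ⬝ᵥ ξ)
    (hA : ∀ x ∈ tsupport η, ∀ i j, |A x i j| ≤ L)
    (hv : ContDiff ℝ ∞ v) (hH : ∀ i, ContDiff ℝ ∞ (H i))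
    (hdiv : ∀ x ∈ tsupport η, ∑ i, partialD i (H i) x = 0) :
    lam / 2 * ∫ x, η x ^ 2 * ∑ i, partialD i v x ^ 2 ≤
      (1 / lam + 1) * (∫ x, η x ^ 2 * ∑ i, (H i x - ∑ j, A x i j * partialD j v x) ^ 2)
      + (4 * (n ^ 2 * L ^ 2 + 1) / lam + 1) * ∫ x, v x ^ 2 * ∑ i, partialD i η x ^ 2 := by
  have cη := hη.continuous
  have cv := hv.continuous
  have cH := fun i => (hH i).continuous
  have cdv := fun i => (partialD_contDiff hv i).continuous
  have cdη := fun i => (partialD_contDiff hη i).continuous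
  have hζ : ContDiff ℝ ∞ fun x => η x ^ 2 * v x := (hη.pow 2).mul hv
  have hζc : HasCompactSupport fun x => η x ^ 2 * v x :=
    (hc.comp_left (g := fun t : ℝ => t ^ 2) (by simp)).mul_right
  have hη2 : HasCompactSupport fun x => η x ^ 2 :=
    hc.comp_left (g := fun t : ℝ => t ^ 2) (by simp)
  have hpd : ∀ i x, partialD i (fun x => η x ^ 2 * v x) x =
      η x ^ 2 * partialD i v x + 2 * η x * v x * partialD i η x := by
    intro i x
    have d1 : DifferentiableAt ℝ η x := hη.contDiffAt.differentiableAt (by simp)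
    have d2 : DifferentiableAt ℝ v x := hv.contDiffAt.differentiableAt (by simp)
    have hη2' : (fun x => η x ^ 2) = fun x => η x * η x := by funext; ring
    have d3 : DifferentiableAt ℝ (fun x => η x ^ 2) x := d1.pow 2
    rw [partialD_mul d3 d2, hη2', partialD_mul d1 d1]
    ring
  have hJ : ∀ i, Integrable (fun x => H i x * partialD i (fun x => η x ^ 2 * v x) x) volume :=
    fun i => ((cH i).mul (partialD_contDiff hζ i).continuous).integrable_of_hasCompactSupport
      (hasCompactSupport_partialD hζc i).mul_left
  have hK : ∀ i, Integrable (fun x => partialD i (H i) x * (η x ^ 2 * v x)) volume :=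
    fun i => ((partialD_contDiff (hH i) i).continuous.mul
      hζ.continuous).integrable_of_hasCompactSupport hζc.mul_left
  -- The equation `div H = 0`, tested with `η² v`.
  have hzero : ∫ x, ∑ i, H i x * partialD i (fun x => η x ^ 2 * v x) x = 0 := by
    rw [integral_finsetSum _ fun i _ => hJ i]
    simp_rw [integral_mul_partialD (hH _) hζ hζc]
    rw [Finset.sum_neg_distrib, ← integral_finsetSum _ fun i _ => hK i, neg_eq_zero]
    refine integral_eq_zero_of_ae (.of_forall fun x => ?_)
    simp only [← Finset.sum_mul, Pi.zero_apply]
    by_cases hx : x ∈ tsupport η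
    · rw [hdiv x hx, zero_mul]
    · rw [image_eq_zero_of_notMem_tsupport hx]
      simp
  have hpt : ∀ x, lam / 2 * (η x ^ 2 * ∑ i, partialD i v x ^ 2) ≤
      ∑ i, H i x * partialD i (fun x => η x ^ 2 * v x) x
      + (1 / lam + 1) * (η x ^ 2 * ∑ i, (H i x - ∑ j, A x i j * partialD j v x) ^ 2)
      + (4 * (n ^ 2 * L ^ 2 + 1) / lam + 1) * (v x ^ 2 * ∑ i, partialD i η x ^ 2) := by
    intro x
    by_cases hx : x ∈ tsupport η
    · have := coercive_pointwise (A x) hlam (hA x hx) (fun i => partialD i v x)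
        (fun i => H i x - ∑ j, A x i j * partialD j v x) (fun i => partialD i η x) (η x) (v x)
        (hell x hx _)
      refine this.trans (le_of_eq ?_)
      congr 2
      refine Finset.sum_congr rfl fun i _ => ?_
      rw [hpd]
      congr 1
      simp [Matrix.mulVec, dotProduct]
    · simp [hpd, image_eq_zero_of_notMem_tsupport hx, partialD_eq_zero_of_notMem hx]
  have i0 : Integrable (fun x => η x ^ 2 * ∑ i, partialD i v x ^ 2) volume :=
    Continuous.integrable_of_hasCompactSupport (by fun_prop) hη2.mul_right
  have i1 : Integrable (fun x => ∑ i, H i x * partialD i (fun x => η x ^ 2 * v x) x) volume :=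
    integrable_finsetSum _ fun i _ => hJ i
  have i2 : Integrable (fun x => η x ^ 2 *
      ∑ i, (H i x - ∑ j, A x i j * partialD j v x) ^ 2) volume :=
    Continuous.integrable_of_hasCompactSupport (by fun_prop) hη2.mul_right
  have i3 : Integrable (fun x => v x ^ 2 * ∑ i, partialD i η x ^ 2) volume := by
    refine Continuous.integrable_of_hasCompactSupport (by fun_prop)
      (hc.mono' fun x hx => ?_)
    by_contra hx'
    apply hx
    simp [partialD_eq_zero_of_notMem hx']
  have := integral_mono (i0.const_mul (lam / 2)) ((i1.add (i2.const_mul _)).add (i3.const_mul _)) hpt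
  rw [integral_const_mul, integral_add' (i1.add (i2.const_mul _)) (i3.const_mul _),
    integral_add' i1 (i2.const_mul _), hzero, integral_const_mul, integral_const_mul] at this
  linarith

end Energy

/-! ### Mollification inside a domain -/

section Local

variable {n : ℕ} {Ω : Set (EuclideanSpace ℝ (Fin n))} {κ : EuclideanSpace ℝ (Fin n) → ℝ}
  {δ : ℝ}

/-- `h` is divergence free in `Ω` in the sense of distributions. -/
def IsDivFree (Ω : Set (EuclideanSpace ℝ (Fin n))) (h : Fin n → EuclideanSpace ℝ (Fin n) → ℝ) :
    Prop :=
  ∀ φ, IsTestFn Ω φ → ∫ x in Ω, ∑ i, h i x * partialD i φ x = 0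

theorem MemL2.memLp_indicator (hΩ : MeasurableSet Ω) {f : EuclideanSpace ℝ (Fin n) → ℝ}
    (hf : MemL2 Ω f) : MemLp (Ω.indicator f) 2 volume :=
  (memLp_indicator_iff_restrict hΩ).mpr hf

theorem integral_indicator_sq (hΩ : MeasurableSet Ω) (f : EuclideanSpace ℝ (Fin n) → ℝ) :
    ∫ x, Ω.indicator f x ^ 2 = ∫ x in Ω, f x ^ 2 := by
  rw [← integral_indicator hΩ]
  congr 1
  funext x
  by_cases hx : x ∈ Ω <;> simp [hx]

theorem conv_indicator (hΩ : MeasurableSet Ω) (κ f : EuclideanSpace ℝ (Fin n) → ℝ)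
    (x : EuclideanSpace ℝ (Fin n)) :
    conv κ (Ω.indicator f) x = ∫ y in Ω, f y * κ (x - y) := by
  rw [conv_apply, ← integral_indicator hΩ]
  congr 1
  funext y
  by_cases hy : y ∈ Ω <;> simp [hy, mul_comm]

theorem hasCompactSupport_of_tsupport_subset_closedBall (hs : tsupport κ ⊆ closedBall 0 δ) :
    HasCompactSupport κ :=
  (isCompact_closedBall 0 δ).of_isClosed_subset (isClosed_tsupport _) hs

theorem isTestFn_translate (hκ : ContDiff ℝ ∞ κ) (hs : tsupport κ ⊆ closedBall 0 δ)
    {x : EuclideanSpace ℝ (Fin n)} (hx : closedBall x δ ⊆ Ω) :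
    IsTestFn Ω (fun y => κ (x - y)) := by
  have hsub : tsupport (fun y => κ (x - y)) ⊆ closedBall x δ := by
    refine closure_minimal (fun y hy => ?_) isClosed_closedBall
    have := hs (subset_tsupport κ hy)
    rw [mem_closedBall_zero_iff] at this
    rwa [mem_closedBall, dist_comm, dist_eq_norm]
  exact ⟨hκ.comp (contDiff_const.sub contDiff_id),
    (isCompact_closedBall x δ).of_isClosed_subset (isClosed_tsupport _) hsub, hsub.trans hx⟩

theorem partialD_translate (hκ : ContDiff ℝ ∞ κ) (x y : EuclideanSpace ℝ (Fin n)) (i : Fin n) :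
    partialD i (fun y => κ (x - y)) y = - partialD i κ (x - y) := by
  have h1 : HasFDerivAt κ (fderiv ℝ κ (x - y)) (x - y) :=
    (hκ.contDiffAt.differentiableAt (by simp)).hasFDerivAt
  have h2 : HasFDerivAt (fun y => x - y) (-(ContinuousLinearMap.id ℝ _)) y :=
    (hasFDerivAt_id y).const_sub x
  have h3 := h1.comp y h2
  change fderiv ℝ (κ ∘ fun y => x - y) y _ = _
  rw [h3.fderiv]
  simp [partialD]

/-- Differentiating a mollification of `u` amounts to mollifying the weak derivative of `u`, at
points of distance at least `δ` to the complement of `Ω`. -/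
theorem HasWeakPartial.conv_partialD_eq (hΩ : MeasurableSet Ω) {i : Fin n}
    {u g : EuclideanSpace ℝ (Fin n) → ℝ} (h : HasWeakPartial Ω i u g)
    (hκ : ContDiff ℝ ∞ κ) (hs : tsupport κ ⊆ closedBall 0 δ)
    {x : EuclideanSpace ℝ (Fin n)} (hx : closedBall x δ ⊆ Ω) :
    conv (partialD i κ) (Ω.indicator u) x = conv κ (Ω.indicator g) x := by
  have := h.integral_eq _ (isTestFn_translate hκ hs hx)
  simp_rw [partialD_translate hκ, mul_neg, integral_neg] at this
  rw [conv_indicator hΩ, conv_indicator hΩ]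
  exact neg_inj.mp this

theorem IsDivFree.sum_partialD_conv_eq_zero (hΩ : MeasurableSet Ω)
    {h : Fin n → EuclideanSpace ℝ (Fin n) → ℝ} (hdiv : IsDivFree Ω h) (hL : ∀ i, MemL2 Ω (h i))
    (hκ : ContDiff ℝ ∞ κ) (hs : tsupport κ ⊆ closedBall 0 δ)
    {x : EuclideanSpace ℝ (Fin n)} (hx : closedBall x δ ⊆ Ω) :
    ∑ i, partialD i (conv κ (Ω.indicator (h i))) x = 0 := by
  have hc := hasCompactSupport_of_tsupport_subset_closedBall hs
  have hloc : ∀ i, LocallyIntegrable (Ω.indicator (h i)) volume := fun i =>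
    ((hL i).memLp_indicator hΩ).locallyIntegrable (by norm_num)
  have := hdiv _ (isTestFn_translate hκ hs hx)
  simp_rw [partialD_translate hκ, mul_neg, Finset.sum_neg_distrib, integral_neg] at this
  rw [integral_finsetSum, neg_eq_zero] at this
  · rw [← this]
    refine Finset.sum_congr rfl fun i _ => ?_
    rw [partialD_conv hκ hc (hloc i), conv_indicator hΩ]
  · intro i _
    have h1 := integrable_conv_integrand (partialD_contDiff hκ i).continuous
      (hasCompactSupport_partialD hc i) (hloc i) x
    refine (h1.integrableOn (s := Ω)).congr ?_
    filter_upwards [ae_restrict_mem hΩ] with y hy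
    simp [hy, mul_comm]

/-- Friedrichs' commutator estimate: mollification commutes with the multiplication by a Lipschitz
function up to an error controlled by the first moment of the kernel. -/
theorem conv_mul_sub_le (hΩ : MeasurableSet Ω) {a g : EuclideanSpace ℝ (Fin n) → ℝ} {L : ℝ}
    (hL : ∀ x ∈ Ω, ∀ y ∈ Ω, |a y - a x| ≤ L * ‖x - y‖) (hg : MemL2 Ω g)
    (hag : MemL2 Ω (fun y => a y * g y)) (hκ : Continuous κ) (hc : HasCompactSupport κ)
    {x : EuclideanSpace ℝ (Fin n)} (hx : x ∈ Ω) :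
    |conv κ (Ω.indicator fun y => a y * g y) x - a x * conv κ (Ω.indicator g) x| ≤
      L * conv (fun z => ‖z‖ * |κ z|) (fun y => |Ω.indicator g y|) x := by
  have l1 : LocallyIntegrable (Ω.indicator fun y => a y * g y) volume :=
    (hag.memLp_indicator hΩ).locallyIntegrable (by norm_num)
  have l2 : LocallyIntegrable (Ω.indicator g) volume :=
    (hg.memLp_indicator hΩ).locallyIntegrable (by norm_num)
  have l3 : LocallyIntegrable (fun y => |Ω.indicator g y|) volume :=
    (hg.memLp_indicator hΩ).norm.locallyIntegrable (by norm_num)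
  have i1 := integrable_conv_integrand hκ hc l1 x
  have i2 := integrable_conv_integrand hκ hc l2 x
  have i3 := integrable_conv_integrand (κ := fun z => ‖z‖ * |κ z|) (by fun_prop)
    (HasCompactSupport.mul_left (hc.comp_left abs_zero)) l3 x
  rw [conv_apply, conv_apply, conv_apply, ← integral_const_mul, ← integral_const_mul,
    ← integral_sub i1 (i2.const_mul _)]
  refine abs_integral_le_integral_abs.trans
    (integral_mono (i1.sub (i2.const_mul _)).abs (i3.const_mul _) fun y => ?_)
  by_cases hy : y ∈ Ω
  · simp only [hy, indicator_of_mem]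
    calc _ = |κ (x - y)| * |g y| * |a y - a x| := by
          rw [← abs_mul, ← abs_mul]
          congr 1
          ring
      _ ≤ |κ (x - y)| * |g y| * (L * ‖x - y‖) := by
          gcongr
          exact hL x hx y hy
      _ = _ := by ring
  · simp [hy]

end Local

/-! ### Caccioppoli's inequality for mollified weak solutions -/

section MollifiedEnergy

variable {n : ℕ} {Ω : Set (EuclideanSpace ℝ (Fin n))}
  {A : EuclideanSpace ℝ (Fin n) → Matrix (Fin n) (Fin n) ℝ}

/-- The coefficient assumptions in the form used below: the entries of `A` are continuous on all of
`ℝⁿ`, which may be assumed by extending them from `Ω`, and `A` is coercive, bounded and Lipschitz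
on `Ω`. -/
structure IsCoeff (Ω : Set (EuclideanSpace ℝ (Fin n))) (lam L : ℝ)
    (A : EuclideanSpace ℝ (Fin n) → Matrix (Fin n) (Fin n) ℝ) : Prop where
  continuous : ∀ i j, Continuous fun x => A x i j
  coercive : ∀ x ∈ Ω, ∀ ξ : Fin n → ℝ, lam * (ξ ⬝ᵥ ξ) ≤ (A x *ᵥ ξ) ⬝ᵥ ξ
  bound : ∀ x ∈ Ω, ∀ i j, |A x i j| ≤ L
  lipschitz : ∀ i j, ∀ x ∈ Ω, ∀ y ∈ Ω, |A y i j - A x i j| ≤ L * ‖x - y‖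

/-- The flux `A g + F`. -/
def flux (A : EuclideanSpace ℝ (Fin n) → Matrix (Fin n) (Fin n) ℝ)
    (g F : Fin n → EuclideanSpace ℝ (Fin n) → ℝ) (i : Fin n)
    (x : EuclideanSpace ℝ (Fin n)) : ℝ :=
  (∑ j, A x i j * g j x) + F i x

variable {lam L : ℝ}

theorem IsCoeff.memL2_mul (hA : IsCoeff Ω lam L A) (hΩ : MeasurableSet Ω) (i j : Fin n)
    {g : EuclideanSpace ℝ (Fin n) → ℝ} (hg : MemL2 Ω g) : MemL2 Ω (fun y => A y i j * g y) := by
  refine MemLp.of_le_mul (c := L) hg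
    ((hA.continuous i j).aestronglyMeasurable.mul hg.aestronglyMeasurable) ?_
  filter_upwards [ae_restrict_mem hΩ] with y hy
  rw [norm_mul]
  gcongr
  exact hA.bound y hy i j

theorem IsCoeff.memL2_flux (hA : IsCoeff Ω lam L A) (hΩ : MeasurableSet Ω)
    {g F : Fin n → EuclideanSpace ℝ (Fin n) → ℝ} (hg : ∀ i, MemL2 Ω (g i))
    (hF : ∀ i, MemL2 Ω (F i)) (i : Fin n) : MemL2 Ω (flux A g F i) :=
  (memLp_finsetSum _ fun j _ => hA.memL2_mul hΩ i j (hg j)).add (hF i)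

theorem conv_flux (hA : IsCoeff Ω lam L A) (hΩ : MeasurableSet Ω)
    {g F : Fin n → EuclideanSpace ℝ (Fin n) → ℝ} (hg : ∀ i, MemL2 Ω (g i))
    (hF : ∀ i, MemL2 Ω (F i)) {κ : EuclideanSpace ℝ (Fin n) → ℝ} (hκ : Continuous κ)
    (hc : HasCompactSupport κ) (i : Fin n) (x : EuclideanSpace ℝ (Fin n)) :
    conv κ (Ω.indicator (flux A g F i)) x =
      (∑ j, conv κ (Ω.indicator fun y => A y i j * g j y) x) + conv κ (Ω.indicator (F i)) x := by
  have int : ∀ {f : EuclideanSpace ℝ (Fin n) → ℝ}, MemL2 Ω f →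
      Integrable (fun y => κ (x - y) * Ω.indicator f y) volume := fun hf =>
    integrable_conv_integrand hκ hc
      ((hf.memLp_indicator hΩ).locallyIntegrable (by norm_num)) x
  simp_rw [conv_apply]
  rw [← integral_finsetSum _ fun j _ => int (hA.memL2_mul hΩ i j (hg j)),
    ← integral_add (integrable_finsetSum _ fun j _ => int (hA.memL2_mul hΩ i j (hg j)))
      (int (hF i))]
  congr 1
  funext y
  by_cases hy : y ∈ Ω <;> simp [hy, flux, mul_add, Finset.mul_sum]

theorem sum_sum_add_sq_le (c : Fin n → Fin n → ℝ) (f P : Fin n → ℝ) (hL : ∀ i j, |c i j| ≤ P j) :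
    ∑ i, ((∑ j, c i j) + f i) ^ 2 ≤ 2 * n ^ 2 * (∑ j, P j ^ 2) + 2 * ∑ i, f i ^ 2 := by
  have h : ∀ i, ((∑ j, c i j) + f i) ^ 2 ≤ 2 * n * (∑ j, P j ^ 2) + 2 * f i ^ 2 := by
    intro i
    have h1 : (∑ j, c i j) ^ 2 ≤ n * ∑ j, P j ^ 2 := by
      have := sq_sum_le_card_mul_sum_sq (s := Finset.univ) (f := fun j => c i j)
      rw [Finset.card_univ, Fintype.card_fin] at this
      refine this.trans ?_
      refine mul_le_mul_of_nonneg_left (Finset.sum_le_sum fun j _ => ?_) (by positivity)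
      exact sq_le_sq' (abs_le.mp (hL i j)).1 (abs_le.mp (hL i j)).2
    nlinarith [sq_nonneg ((∑ j, c i j) - f i)]
  refine (Finset.sum_le_sum fun i _ => h i).trans (le_of_eq ?_)
  rw [Finset.sum_add_distrib, ← Finset.mul_sum (f := fun i => f i ^ 2), Finset.sum_const, Finset.card_univ,
    Fintype.card_fin, nsmul_eq_mul]
  ring

/-- Caccioppoli's inequality for the mollification `v = κ * u` of a weak solution, with the square
of the first moment of the kernel as the factor in front of `‖∇u‖²`. It serves both for a
mollifier, whose first moment is small, and for a derivative of a mollifier, whose first moment is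
bounded independently of the scale. -/
theorem mollified_energy_le (hA : IsCoeff Ω lam L A) (hlam : 0 < lam) (hΩ : MeasurableSet Ω)
    {u : EuclideanSpace ℝ (Fin n) → ℝ} {g F : Fin n → EuclideanSpace ℝ (Fin n) → ℝ}
    (hu : MemL2 Ω u) (hg : ∀ i, MemL2 Ω (g i)) (hF : ∀ i, MemL2 Ω (F i))
    (hug : ∀ i, HasWeakPartial Ω i u (g i)) (hdiv : IsDivFree Ω (flux A g F))
    {κ η : EuclideanSpace ℝ (Fin n) → ℝ} {δ D : ℝ} (hδ : 0 ≤ δ)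
    (hκ : ContDiff ℝ ∞ κ) (hs : tsupport κ ⊆ closedBall 0 δ)
    (hη : ContDiff ℝ ∞ η) (hc : HasCompactSupport η) (hη1 : ∀ x, |η x| ≤ 1)
    (hD : ∀ x, ∑ i, partialD i η x ^ 2 ≤ D) (hsη : ∀ x ∈ tsupport η, closedBall x δ ⊆ Ω) :
    lam / 2 * ∫ x, η x ^ 2 * ∑ i, partialD i (conv κ (Ω.indicator u)) x ^ 2 ≤
      (1 / lam + 1) * (2 * n ^ 2 * L ^ 2 * (∫ z, ‖z‖ * |κ z|) ^ 2 * (∑ j, ∫ x in Ω, g j x ^ 2)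
        + 2 * ∑ i, ∫ x in tsupport η, conv κ (Ω.indicator (F i)) x ^ 2)
      + (4 * (n ^ 2 * L ^ 2 + 1) / lam + 1) *
        (D * ∫ x in tsupport η, conv κ (Ω.indicator u) x ^ 2) := by
  have hκc := hasCompactSupport_of_tsupport_subset_closedBall hs
  have hself : ∀ x ∈ tsupport η, x ∈ Ω := fun x hx => hsη x hx (mem_closedBall_self hδ)
  have loc : ∀ {f : EuclideanSpace ℝ (Fin n) → ℝ}, MemL2 Ω f →
      LocallyIntegrable (Ω.indicator f) volume := fun hf =>
    (hf.memLp_indicator hΩ).locallyIntegrable (by norm_num)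
  have hflux := hA.memL2_flux hΩ hg hF
  set v := conv κ (Ω.indicator u) with hv
  have hvs : ContDiff ℝ ∞ v := conv_contDiff hκ hκc (loc hu)
  have hHs : ∀ i, ContDiff ℝ ∞ (conv κ (Ω.indicator (flux A g F i))) := fun i =>
    conv_contDiff hκ hκc (loc (hflux i))
  have hen := energy_le hlam hA.continuous hη hc (fun x hx => hA.coercive x (hself x hx))
    (fun x hx => hA.bound x (hself x hx)) hvs hHs
    (fun x hx => hdiv.sum_partialD_conv_eq_zero hΩ hflux hκ hs (hsη x hx))
  set K : EuclideanSpace ℝ (Fin n) → ℝ := fun z => ‖z‖ * |κ z| with hK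
  have hKcont : Continuous K := continuous_norm.mul hκ.continuous.abs
  have hKc : HasCompactSupport K := HasCompactSupport.mul_left (hκc.comp_left abs_zero)
  have hP := fun j => memLp_conv hKcont hKc ((hg j).memLp_indicator hΩ).norm
  set P : Fin n → EuclideanSpace ℝ (Fin n) → ℝ :=
    fun j => conv K (fun y => |Ω.indicator (g j) y|) with hPdef
  have hPint : ∀ j, Integrable (fun x => P j x ^ 2) volume := fun j => (hP j).1.integrable_sq
  have hPle : ∀ j, ∫ x in tsupport η, P j x ^ 2 ≤ (∫ z, K z) ^ 2 * ∫ x in Ω, g j x ^ 2 := by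
    intro j
    refine (setIntegral_le_integral (hPint j) (.of_forall fun x => sq_nonneg _)).trans ?_
    refine (hP j).2.trans (le_of_eq ?_)
    rw [← integral_indicator_sq hΩ]
    congr 2
    · congr 1
      funext z
      rw [abs_of_nonneg (by positivity)]
    · funext y
      simp
  have hcF : ∀ i, Continuous (conv κ (Ω.indicator (F i))) := fun i =>
    (conv_contDiff hκ hκc (loc (hF i))).continuous
  have hcFint : ∀ i, IntegrableOn (fun x => conv κ (Ω.indicator (F i)) x ^ 2) (tsupport η) :=
    fun i => ((hcF i).pow 2).continuousOn.integrableOn_compact hc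
  have hpt : ∀ x, η x ^ 2 * ∑ i, (conv κ (Ω.indicator (flux A g F i)) x
      - ∑ j, A x i j * partialD j v x) ^ 2 ≤ (tsupport η).indicator (fun x =>
        2 * n ^ 2 * (∑ j, L ^ 2 * P j x ^ 2) + 2 * ∑ i, conv κ (Ω.indicator (F i)) x ^ 2) x := by
    intro x
    by_cases hx : x ∈ tsupport η
    · rw [indicator_of_mem hx]
      have h1 := sum_sum_add_sq_le
        (fun i j => conv κ (Ω.indicator fun y => A y i j * g j y) x
          - A x i j * conv κ (Ω.indicator (g j)) x) (fun i => conv κ (Ω.indicator (F i)) x)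
        (fun j => L * P j x) (fun i j => conv_mul_sub_le hΩ (hA.lipschitz i j) (hg j)
          (hA.memL2_mul hΩ i j (hg j)) hκ.continuous hκc (hself x hx))
      have h2 : ∀ j, partialD j v x = conv κ (Ω.indicator (g j)) x := fun j => by
        rw [hv, partialD_conv hκ hκc (loc hu)]
        exact (hug j).conv_partialD_eq hΩ hκ hs (hsη x hx)
      have h3 : η x ^ 2 ≤ 1 := by
        rw [← sq_abs]
        exact pow_le_one₀ (abs_nonneg _) (hη1 x)
      refine (mul_le_of_le_one_left (by positivity) h3).trans ?_
      simp_rw [mul_pow] at h1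
      refine le_trans (le_of_eq ?_) h1
      refine Finset.sum_congr rfl fun i _ => ?_
      rw [conv_flux hA hΩ hg hF hκ.continuous hκc]
      simp_rw [h2, Finset.sum_sub_distrib]
      ring
    · rw [image_eq_zero_of_notMem_tsupport hx, indicator_of_notMem hx]
      simp
  have hm := hc.measurableSet
  have hbig : IntegrableOn (fun x => 2 * n ^ 2 * (∑ j, L ^ 2 * P j x ^ 2)
      + 2 * ∑ i, conv κ (Ω.indicator (F i)) x ^ 2) (tsupport η) :=
    Integrable.add (Integrable.const_mul (integrable_finsetSum _ fun j _ =>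
      ((hPint j).const_mul _).integrableOn) _)
      (Integrable.const_mul (integrable_finsetSum _ fun i _ => hcFint i) _)
  have hη2 : HasCompactSupport fun x => η x ^ 2 :=
    hc.comp_left (g := fun t : ℝ => t ^ 2) (by simp)
  have t1 : ∫ x, η x ^ 2 * ∑ i, (conv κ (Ω.indicator (flux A g F i)) x
      - ∑ j, A x i j * partialD j v x) ^ 2 ≤
      2 * n ^ 2 * L ^ 2 * (∫ z, K z) ^ 2 * (∑ j, ∫ x in Ω, g j x ^ 2)
        + 2 * ∑ i, ∫ x in tsupport η, conv κ (Ω.indicator (F i)) x ^ 2 := by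
    have cdv := fun i => (partialD_contDiff hvs i).continuous
    have cH := fun i => (hHs i).continuous
    have cA := hA.continuous
    have cη := hη.continuous
    have i2 : Integrable (fun x => η x ^ 2 * ∑ i, (conv κ (Ω.indicator (flux A g F i)) x
        - ∑ j, A x i j * partialD j v x) ^ 2) volume :=
      Continuous.integrable_of_hasCompactSupport (by fun_prop) hη2.mul_right
    refine (integral_mono i2 (hbig.integrable_indicator hm) hpt).trans ?_
    rw [integral_indicator hm, integral_add, integral_const_mul, integral_const_mul,
      integral_finsetSum, integral_finsetSum]
    · refine add_le_add_left ?_ _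
      calc 2 * (n : ℝ) ^ 2 * ∑ j, ∫ x in tsupport η, L ^ 2 * P j x ^ 2
          = 2 * n ^ 2 * (L ^ 2 * ∑ j, ∫ x in tsupport η, P j x ^ 2) := by
            simp_rw [integral_const_mul, ← Finset.mul_sum]
        _ ≤ 2 * n ^ 2 * (L ^ 2 * ∑ j, (∫ z, K z) ^ 2 * ∫ x in Ω, g j x ^ 2) := by
            gcongr with j
            exact hPle j
        _ = _ := by rw [← Finset.mul_sum]; ring
    · exact fun i _ => hcFint i
    · exact fun j _ => ((hPint j).const_mul _).integrableOn
    · exact Integrable.const_mul (integrable_finsetSum _ fun j _ =>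
        ((hPint j).const_mul _).integrableOn) _
    · exact Integrable.const_mul (integrable_finsetSum _ fun i _ => hcFint i) _
  have t2 : ∫ x, v x ^ 2 * ∑ i, partialD i η x ^ 2 ≤ D * ∫ x in tsupport η, v x ^ 2 := by
    have cv := hvs.continuous
    have cdη := fun i => (partialD_contDiff hη i).continuous
    have hz : ∀ x ∉ tsupport η, v x ^ 2 * ∑ i, partialD i η x ^ 2 = 0 := fun x hx => by
      simp [partialD_eq_zero_of_notMem hx]
    rw [← setIntegral_eq_integral_of_forall_compl_eq_zero hz, ← integral_const_mul]
    have c1 : Continuous fun x => v x ^ 2 * ∑ i, partialD i η x ^ 2 := by fun_prop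
    refine integral_mono (c1.continuousOn.integrableOn_compact hc)
      (((cv.pow 2).continuousOn.integrableOn_compact hc).const_mul D) fun x => ?_
    rw [mul_comm]
    exact mul_le_mul_of_nonneg_right (hD x) (sq_nonneg _)
  have hl : 0 ≤ 1 / lam + 1 := by positivity
  have hl' : 0 ≤ 4 * (n ^ 2 * L ^ 2 + 1) / lam + 1 := by positivity
  exact hen.trans (add_le_add (mul_le_mul_of_nonneg_left t1 hl) (mul_le_mul_of_nonneg_left t2 hl'))

end MollifiedEnergy

/-! ### Mollifiers -/

section Mollifier

variable {n : ℕ}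

/-- `ρ` is a mollifier of scale `δ`: a smooth nonnegative function of integral `1` supported in the
closed ball of radius `δ`. -/
structure IsMollifier (δ : ℝ) (ρ : EuclideanSpace ℝ (Fin n) → ℝ) : Prop where
  contDiff : ContDiff ℝ ∞ ρ
  tsupport_subset : tsupport ρ ⊆ closedBall 0 δ
  nonneg : ∀ x, 0 ≤ ρ x
  integral_eq_one : ∫ x, ρ x = 1

/-- The first moment of the derivatives of `x ↦ δ⁻ⁿ b (x / δ)` does not depend on `δ`. -/
theorem exists_isMollifier (n : ℕ) : ∃ C : ℝ, ∀ δ : ℝ, 0 < δ →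
    ∃ ρ : EuclideanSpace ℝ (Fin n) → ℝ, IsMollifier δ ρ ∧
      ∀ k, ∫ z, ‖z‖ * |partialD k ρ z| ≤ C := by
  let β : ContDiffBump (0 : EuclideanSpace ℝ (Fin n)) := ⟨1 / 2, 1, by norm_num, by norm_num⟩
  set b := β.normed volume with hb
  have hbs : ContDiff ℝ ∞ b := β.contDiff_normed
  refine ⟨∑ k, ∫ z, ‖z‖ * |partialD k b z|, fun δ hδ => ?_⟩
  have hρ : ContDiff ℝ ∞ fun x : EuclideanSpace ℝ (Fin n) => (δ ^ n)⁻¹ * b (δ⁻¹ • x) :=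
    contDiff_const.mul (hbs.comp (contDiff_const_smul _))
  refine ⟨fun x => (δ ^ n)⁻¹ * b (δ⁻¹ • x), ⟨hρ, ?_, ?_, ?_⟩, ?_⟩
  · refine closure_minimal (fun x hx => ?_) isClosed_closedBall
    have h1 : δ⁻¹ • x ∈ tsupport b := subset_tsupport b (right_ne_zero_of_mul hx)
    rw [hb, β.tsupport_normed_eq, mem_closedBall_zero_iff, norm_smul, norm_inv,
      Real.norm_of_nonneg hδ.le, inv_mul_le_iff₀ hδ] at h1
    rw [mem_closedBall_zero_iff]
    simpa [β] using h1
  · exact fun x => mul_nonneg (by positivity) (β.nonneg_normed _)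
  · rw [integral_const_mul, Measure.integral_comp_inv_smul_of_nonneg _ _ hδ.le, hb,
      β.integral_normed, finrank_euclideanSpace_fin]
    simp [hδ.ne']
  · intro k
    have hpd : ∀ z, partialD k (fun x => (δ ^ n)⁻¹ * b (δ⁻¹ • x)) z =
        (δ ^ n)⁻¹ * (δ⁻¹ * partialD k b (δ⁻¹ • z)) := by
      intro z
      have h1 : HasFDerivAt b (fderiv ℝ b (δ⁻¹ • z)) (δ⁻¹ • z) :=
        (hbs.contDiffAt.differentiableAt (by simp)).hasFDerivAt
      have h2 := (h1.comp z ((hasFDerivAt_id z).const_smul δ⁻¹)).const_mul (δ ^ n)⁻¹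
      have h3 : fderiv ℝ (fun x => (δ ^ n)⁻¹ * b (δ⁻¹ • x)) z = _ := h2.fderiv
      rw [partialD, h3]
      simp [partialD]
    obtain ⟨q, hq⟩ : ∃ q : EuclideanSpace ℝ (Fin n) → ℝ, q = fun y => ‖y‖ * |partialD k b y| :=
      ⟨_, rfl⟩
    have heq : (fun z => ‖z‖ * |partialD k (fun x => (δ ^ n)⁻¹ * b (δ⁻¹ • x)) z|) =
        fun z => (δ ^ n)⁻¹ * q (δ⁻¹ • z) := by
      funext z
      rw [hpd, hq]
      beta_reduce
      rw [abs_mul, abs_mul, norm_smul, abs_of_pos (inv_pos.mpr (pow_pos hδ n)),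
        abs_of_pos (inv_pos.mpr hδ), Real.norm_of_nonneg (inv_pos.mpr hδ).le]
      ring
    rw [heq, integral_const_mul, Measure.integral_comp_inv_smul_of_nonneg _ _ hδ.le,
      finrank_euclideanSpace_fin, smul_eq_mul, inv_mul_cancel_left₀ (by positivity), hq]
    exact Finset.single_le_sum
      (f := fun k => ∫ z : EuclideanSpace ℝ (Fin n), ‖z‖ * |partialD k b z|)
      (fun k _ => integral_nonneg fun z => by positivity) (Finset.mem_univ k)

variable {δ : ℝ} {ρ : EuclideanSpace ℝ (Fin n) → ℝ}

theorem IsMollifier.hasCompactSupport (h : IsMollifier δ ρ) : HasCompactSupport ρ :=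
  hasCompactSupport_of_tsupport_subset_closedBall h.tsupport_subset

theorem IsMollifier.integrable (h : IsMollifier δ ρ) : Integrable ρ volume :=
  h.contDiff.continuous.integrable_of_hasCompactSupport h.hasCompactSupport

theorem IsMollifier.norm_le (h : IsMollifier δ ρ) {z : EuclideanSpace ℝ (Fin n)} (hz : ρ z ≠ 0) :
    ‖z‖ ≤ δ :=
  mem_closedBall_zero_iff.mp (h.tsupport_subset (subset_tsupport ρ hz))

theorem IsMollifier.integral_abs_eq_one (h : IsMollifier δ ρ) : ∫ z, |ρ z| = 1 := by
  simp_rw [abs_of_nonneg (h.nonneg _)]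
  exact h.integral_eq_one

theorem IsMollifier.integral_norm_mul_le (h : IsMollifier δ ρ) : ∫ z, ‖z‖ * |ρ z| ≤ δ := by
  have hc := h.contDiff.continuous
  have h1 : Integrable (fun z => ‖z‖ * |ρ z|) volume :=
    Continuous.integrable_of_hasCompactSupport (by fun_prop)
      (HasCompactSupport.mul_left (h.hasCompactSupport.comp_left abs_zero))
  calc ∫ z, ‖z‖ * |ρ z| ≤ ∫ z, δ * |ρ z| := by
        refine integral_mono h1 (h.integrable.abs.const_mul δ) fun z => ?_
        by_cases hz : ρ z = 0
        · simp [hz]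
        · exact mul_le_mul_of_nonneg_right (h.norm_le hz) (abs_nonneg _)
    _ = δ := by rw [integral_const_mul, h.integral_abs_eq_one, mul_one]

/-- Mollifications converge weakly, tested against continuous functions of compact support. -/
theorem tendsto_integral_conv_mul {δ : ℕ → ℝ} {ρ : ℕ → EuclideanSpace ℝ (Fin n) → ℝ}
    (hρ : ∀ m, IsMollifier (δ m) (ρ m)) (hδ : Filter.Tendsto δ Filter.atTop (nhds 0))
    {f ψ : EuclideanSpace ℝ (Fin n) → ℝ} (hf : Integrable f volume) (hψ : Continuous ψ)
    (hc : HasCompactSupport ψ) :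
    Filter.Tendsto (fun m => ∫ x, conv (ρ m) f x * ψ x) Filter.atTop (nhds (∫ x, f x * ψ x)) := by
  obtain ⟨B, hB⟩ := hψ.bounded_above_of_compact_support hc
  have hfψ : Integrable (fun x => f x * ψ x) volume :=
    hf.mul_bdd hψ.aestronglyMeasurable (.of_forall hB)
  -- Fubini moves the mollifier onto `ψ`.
  have hswap : ∀ m, ∫ x, conv (ρ m) f x * ψ x = ∫ y, f y * ∫ x, ρ m (x - y) * ψ x := by
    intro m
    have hint : Integrable (fun p : EuclideanSpace ℝ (Fin n) × EuclideanSpace ℝ (Fin n) =>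
        f p.2 * ρ m (p.1 - p.2) * ψ p.1) (volume.prod volume) := by
      refine Integrable.mul_bdd (c := B) ?_ (by fun_prop) (.of_forall fun p => hB _)
      exact hf.convolution_integrand (ContinuousLinearMap.mul ℝ ℝ) (hρ m).integrable
    calc ∫ x, conv (ρ m) f x * ψ x = ∫ x, ∫ y, f y * ρ m (x - y) * ψ x := by
          congr 1
          funext x
          rw [conv_apply, ← integral_mul_const]
          simp_rw [mul_comm]
      _ = ∫ y, ∫ x, f y * ρ m (x - y) * ψ x := integral_integral_swap hint
      _ = _ := by simp_rw [mul_assoc, integral_const_mul]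
  have hunif := hc.uniformContinuous_of_continuous hψ
  rw [Metric.tendsto_atTop]
  intro ε hε
  set N := ∫ y, |f y| with hN
  have hN0 : 0 ≤ N := integral_nonneg fun y => abs_nonneg _
  obtain ⟨r, hr, hrψ⟩ := Metric.uniformContinuous_iff.mp hunif (ε / (N + 1)) (by positivity)
  obtain ⟨m₀, hm₀⟩ := Metric.tendsto_atTop.mp hδ r hr
  refine ⟨m₀, fun m hm => ?_⟩
  have hδm : δ m < r := (le_abs_self _).trans_lt (by simpa using hm₀ m hm)
  have hρc := (hρ m).contDiff.continuous
  have hin : ∀ y, |(∫ x, ρ m (x - y) * ψ x) - ψ y| ≤ ε / (N + 1) := by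
    intro y
    have j1 : Integrable (fun x => ρ m (x - y)) volume := (hρ m).integrable.comp_sub_right y
    have j2 : Integrable (fun x => ρ m (x - y) * ψ x) volume :=
      j1.mul_bdd hψ.aestronglyMeasurable (.of_forall hB)
    have h1 : ∫ x, ρ m (x - y) = 1 := by
      rw [integral_sub_right_eq_self (ρ m) y, (hρ m).integral_eq_one]
    calc |(∫ x, ρ m (x - y) * ψ x) - ψ y|
        = |∫ x, (ρ m (x - y) * ψ x - ρ m (x - y) * ψ y)| := by
          rw [integral_sub j2 (j1.mul_const _), integral_mul_const, h1, one_mul]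
      _ ≤ ∫ x, |ρ m (x - y) * ψ x - ρ m (x - y) * ψ y| := abs_integral_le_integral_abs
      _ ≤ ∫ x, ρ m (x - y) * (ε / (N + 1)) := by
          refine integral_mono (j2.sub (j1.mul_const _)).abs (j1.mul_const _) fun x => ?_
          change |ρ m (x - y) * ψ x - ρ m (x - y) * ψ y| ≤ _
          rw [← mul_sub, abs_mul, abs_of_nonneg ((hρ m).nonneg _)]
          by_cases hz : ρ m (x - y) = 0
          · simp [hz]
          · refine mul_le_mul_of_nonneg_left (hrψ ?_).le ((hρ m).nonneg _)
            rw [dist_eq_norm]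
            exact ((hρ m).norm_le hz).trans_lt hδm
      _ = ε / (N + 1) := by rw [integral_mul_const, h1, one_mul]
  have hmeas : Continuous fun y => ∫ x, ρ m (x - y) * ψ x := by
    have h2 : HasCompactSupport fun z => ρ m (-z) :=
      (hρ m).hasCompactSupport.comp_homeomorph (Homeomorph.neg _)
    have h3 := h2.continuous_convolution_left (μ := volume) (ContinuousLinearMap.mul ℝ ℝ)
      (hρc.comp continuous_neg) hψ.locallyIntegrable
    refine h3.congr fun y => ?_
    rw [convolution_eq_swap]
    simp
  have j3 : Integrable (fun y => f y * ∫ x, ρ m (x - y) * ψ x) volume := by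
    refine hf.mul_bdd (c := B + ε / (N + 1)) hmeas.aestronglyMeasurable (.of_forall fun y => ?_)
    have h5 := hB y
    have h6 := hin y
    rw [Real.norm_eq_abs] at h5 ⊢
    have h7 := abs_add_le ((∫ x, ρ m (x - y) * ψ x) - ψ y) (ψ y)
    rw [sub_add_cancel] at h7
    linarith
  rw [hswap, Real.dist_eq, ← integral_sub j3 hfψ]
  calc _ ≤ ∫ y, |f y * (∫ x, ρ m (x - y) * ψ x) - f y * ψ y| := abs_integral_le_integral_abs
    _ ≤ ∫ y, |f y| * (ε / (N + 1)) := by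
        refine integral_mono (j3.sub hfψ).abs (hf.abs.mul_const _) fun y => ?_
        change |f y * (∫ x, ρ m (x - y) * ψ x) - f y * ψ y| ≤ _
        rw [← mul_sub, abs_mul]
        exact mul_le_mul_of_nonneg_left (hin y) (abs_nonneg _)
    _ = N * (ε / (N + 1)) := integral_mul_const _ _
    _ < ε := by
        rw [mul_div_assoc', div_lt_iff₀ (by positivity)]
        nlinarith

end Mollifier

/-! ### Weak derivatives of weak limits -/

section WeakLimit

/-- Riesz representation of a functional which is bounded with respect to the seminorm `‖T v‖`. -/
theorem exists_inner_eq_of_abs_le {V H : Type*} [AddCommGroup V] [Module ℝ V]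
    [NormedAddCommGroup H] [InnerProductSpace ℝ H] [CompleteSpace H] (T : V →ₗ[ℝ] H)
    (ℓ : V →ₗ[ℝ] ℝ) {M : ℝ} (hM : 0 ≤ M) (h : ∀ v, |ℓ v| ≤ M * ‖T v‖) :
    ∃ w : H, ‖w‖ ≤ M ∧ ∀ v, inner ℝ w (T v) = ℓ v := by
  -- The bound makes `ℓ` vanish on the kernel of `T`, so `ℓ` factors through `T`.
  have hmem : ℓ ∈ LinearMap.range T.dualMap := by
    rw [LinearMap.range_dualMap_eq_dualAnnihilator_ker, Submodule.mem_dualAnnihilator]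
    intro v hv
    have := h v
    rw [LinearMap.mem_ker.mp hv, norm_zero, mul_zero] at this
    exact abs_nonpos_iff.mp this
  obtain ⟨f, hf⟩ := hmem
  let f₀ : LinearMap.range T →L[ℝ] ℝ := (f.comp (LinearMap.range T).subtype).mkContinuous M (by
    rintro ⟨_, v, rfl⟩
    have : f (T v) = ℓ v := by rw [← hf]; rfl
    simpa [this] using h v)
  obtain ⟨f₁, hf₁, hn⟩ := exists_extension_norm_eq (LinearMap.range T) f₀
  refine ⟨(InnerProductSpace.toDual ℝ H).symm f₁, ?_, fun v => ?_⟩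
  · rw [LinearIsometryEquiv.norm_map, hn]
    exact LinearMap.mkContinuous_norm_le _ hM _
  · rw [InnerProductSpace.toDual_symm_apply]
    have := hf₁ ⟨T v, v, rfl⟩
    rw [this, ← hf]
    rfl

variable {n : ℕ} {Ω : Set (EuclideanSpace ℝ (Fin n))}

/-- The space `C_c^∞(Ω)`. -/
def testFns (Ω : Set (EuclideanSpace ℝ (Fin n))) :
    Submodule ℝ (EuclideanSpace ℝ (Fin n) → ℝ) where
  carrier := {φ | IsTestFn Ω φ}
  zero_mem' := ⟨contDiff_const, HasCompactSupport.zero, by simp [tsupport]⟩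
  add_mem' := fun {a b} ha hb => ⟨ha.contDiff.add hb.contDiff,
    ha.hasCompactSupport.add hb.hasCompactSupport,
    (tsupport_add a b).trans (union_subset ha.tsupport_subset hb.tsupport_subset)⟩
  smul_mem' := fun c φ hφ => ⟨contDiff_const.mul hφ.contDiff, hφ.hasCompactSupport.mul_left,
    (closure_mono (Function.support_const_smul_subset c φ)).trans hφ.tsupport_subset⟩

theorem IsTestFn.memL2 {φ : EuclideanSpace ℝ (Fin n) → ℝ} (hφ : IsTestFn Ω φ) : MemL2 Ω φ :=
  (hφ.contDiff.continuous.memLp_of_hasCompactSupport hφ.hasCompactSupport).restrict Ω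

theorem IsTestFn.partialD {φ : EuclideanSpace ℝ (Fin n) → ℝ} (hφ : IsTestFn Ω φ) (i : Fin n) :
    IsTestFn Ω (partialD i φ) :=
  ⟨partialD_contDiff hφ.contDiff i, hasCompactSupport_partialD hφ.hasCompactSupport i,
    (tsupport_partialD_subset φ i).trans hφ.tsupport_subset⟩

theorem IsTestFn.setIntegral_mul {φ : EuclideanSpace ℝ (Fin n) → ℝ} (hφ : IsTestFn Ω φ)
    (f : EuclideanSpace ℝ (Fin n) → ℝ) : ∫ x in Ω, f x * φ x = ∫ x, f x * φ x := by
  refine setIntegral_eq_integral_of_forall_compl_eq_zero fun x hx => ?_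
  rw [image_eq_zero_of_notMem_tsupport fun h => hx (hφ.tsupport_subset h), mul_zero]

theorem IsTestFn.integrable_mul {u φ : EuclideanSpace ℝ (Fin n) → ℝ}
    (hu : LocallyIntegrableOn u Ω volume) (hφ : IsTestFn Ω φ) :
    IntegrableOn (fun x => u x * φ x) Ω volume := by
  have h1 : IntegrableOn (fun x => u x * φ x) (tsupport φ) volume :=
    (hu.integrableOn_compact_subset hφ.tsupport_subset hφ.hasCompactSupport).mul_continuousOn
      hφ.contDiff.continuous.continuousOn hφ.hasCompactSupport
  have h2 : Integrable (fun x => u x * φ x) volume :=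
    (integrableOn_iff_integrable_of_support_subset
      ((Function.support_mul_subset_right u φ).trans (subset_tsupport φ))).mp h1
  exact h2.integrableOn

theorem MemL2.locallyIntegrableOn {f : EuclideanSpace ℝ (Fin n) → ℝ} (hf : MemL2 Ω f) :
    LocallyIntegrableOn f Ω volume :=
  locallyIntegrableOn_of_locallyIntegrable_restrict (MemLp.locallyIntegrable hf (by norm_num))

theorem norm_toLp_sq {f : EuclideanSpace ℝ (Fin n) → ℝ} (hf : MemL2 Ω f) :
    ‖MemLp.toLp f hf‖ ^ 2 = ∫ x in Ω, f x ^ 2 := by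
  rw [← real_inner_self_eq_norm_sq, L2.inner_def]
  refine integral_congr_ae ?_
  filter_upwards [hf.coeFn_toLp] with x hx
  simp [hx, sq]

theorem inner_toLp (w : Lp ℝ 2 (volume.restrict Ω)) {f : EuclideanSpace ℝ (Fin n) → ℝ}
    (hf : MemL2 Ω f) : inner ℝ w (MemLp.toLp f hf) = ∫ x in Ω, w x * f x := by
  rw [L2.inner_def]
  refine integral_congr_ae ?_
  filter_upwards [hf.coeFn_toLp] with x hx
  simp [hx, mul_comm]

theorem abs_integral_mul_le {f g : EuclideanSpace ℝ (Fin n) → ℝ} (hf : MemL2 Ω f)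
    (hg : MemL2 Ω g) :
    |∫ x in Ω, f x * g x| ≤ √(∫ x in Ω, f x ^ 2) * ‖MemLp.toLp g hg‖ := by
  rw [← norm_toLp_sq hf, Real.sqrt_sq (norm_nonneg _)]
  refine le_trans (le_of_eq ?_) (abs_real_inner_le_norm (MemLp.toLp f hf) (MemLp.toLp g hg))
  rw [inner_toLp]
  congr 1
  refine integral_congr_ae ?_
  filter_upwards [hf.coeFn_toLp] with x hx
  rw [hx]

/-- If smooth functions `w m` converge weakly to `u` and the `L²` norms of their derivatives stay
bounded, then `u` has a weak derivative in `L²`, whose norm obeys the limiting bound. -/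
theorem exists_hasWeakPartial_of_tendsto {u : EuclideanSpace ℝ (Fin n) → ℝ}
    (hu : LocallyIntegrableOn u Ω volume) (j : Fin n) {w : ℕ → EuclideanSpace ℝ (Fin n) → ℝ}
    (hw : ∀ m, ContDiff ℝ ∞ (w m)) (hw2 : ∀ m, MemL2 Ω (partialD j (w m))) {M : ℕ → ℝ} {M₀ : ℝ}
    (hwM : ∀ m, ∫ x in Ω, partialD j (w m) x ^ 2 ≤ M m)
    (hM : Filter.Tendsto M Filter.atTop (nhds M₀))
    (hconv : ∀ ψ, IsTestFn Ω ψ →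
      Filter.Tendsto (fun m => ∫ x in Ω, w m x * ψ x) Filter.atTop (nhds (∫ x in Ω, u x * ψ x))) :
    ∃ g, HasWeakPartial Ω j u g ∧ MemL2 Ω g ∧ ∫ x in Ω, g x ^ 2 ≤ M₀ := by
  have hM0 : 0 ≤ M₀ := ge_of_tendsto' hM fun m =>
    (integral_nonneg fun x => sq_nonneg _).trans (hwM m)
  let T : testFns Ω →ₗ[ℝ] Lp ℝ 2 (volume.restrict Ω) :=
    { toFun := fun φ => MemLp.toLp φ.1 (IsTestFn.memL2 φ.2)
      map_add' := fun φ ψ => MemLp.toLp_add _ _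
      map_smul' := fun c φ => MemLp.toLp_const_smul c _ }
  have hpadd : ∀ {φ ψ : EuclideanSpace ℝ (Fin n) → ℝ}, IsTestFn Ω φ → IsTestFn Ω ψ → ∀ x,
      partialD j (φ + ψ) x = partialD j φ x + partialD j ψ x := by
    intro φ ψ hφ hψ x
    rw [partialD, fderiv_add (hφ.contDiff.contDiffAt.differentiableAt (by simp))
      (hψ.contDiff.contDiffAt.differentiableAt (by simp))]
    rfl
  have hpsmul : ∀ (c : ℝ) {φ : EuclideanSpace ℝ (Fin n) → ℝ}, IsTestFn Ω φ → ∀ x,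
      partialD j (c • φ) x = c * partialD j φ x := by
    intro c φ hφ x
    rw [partialD, fderiv_const_smul (hφ.contDiff.contDiffAt.differentiableAt (by simp))]
    rfl
  let ℓ : testFns Ω →ₗ[ℝ] ℝ :=
    { toFun := fun φ => - ∫ x in Ω, u x * partialD j φ.1 x
      map_add' := fun φ ψ => by
        simp only [Submodule.coe_add, hpadd φ.2 ψ.2, mul_add]
        rw [integral_add (IsTestFn.integrable_mul hu (IsTestFn.partialD φ.2 j))
          (IsTestFn.integrable_mul hu (IsTestFn.partialD ψ.2 j)), neg_add]
      map_smul' := fun c φ => by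
        simp only [Submodule.coe_smul, hpsmul c φ.2, mul_left_comm _ c, integral_const_mul,
          RingHom.id_apply, smul_eq_mul, mul_neg] }
  -- Pass to the limit in `|∫ w m ∂_j φ| = |∫ ∂_j (w m) φ| ≤ √(M m) ‖φ‖`.
  have hbound : ∀ φ, |ℓ φ| ≤ √M₀ * ‖T φ‖ := by
    intro φ
    have hφ : IsTestFn Ω φ.1 := φ.2
    have h1 := (hconv _ (hφ.partialD j)).abs
    have h2 := hM.sqrt.mul_const ‖T φ‖
    change |-∫ x in Ω, u x * partialD j φ.1 x| ≤ _
    rw [abs_neg]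
    refine le_of_tendsto_of_tendsto' h1 h2 fun m => ?_
    rw [(hφ.partialD j).setIntegral_mul, integral_mul_partialD (hw m) hφ.contDiff
      hφ.hasCompactSupport, abs_neg, ← hφ.setIntegral_mul]
    refine (abs_integral_mul_le (hw2 m) hφ.memL2).trans ?_
    exact mul_le_mul_of_nonneg_right (Real.sqrt_le_sqrt (hwM m)) (norm_nonneg _)
  obtain ⟨g, hg, hgl⟩ := exists_inner_eq_of_abs_le T ℓ (Real.sqrt_nonneg _) hbound
  have hgL : MemL2 Ω g := Lp.memLp g
  refine ⟨g, ⟨hu, ?_, fun φ hφ => ?_⟩, hgL, ?_⟩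
  · exact hgL.locallyIntegrableOn
  · have := hgl ⟨φ, hφ⟩
    rw [← inner_toLp g hφ.memL2, ← neg_eq_iff_eq_neg]
    exact this.symm
  · rw [← norm_toLp_sq hgL, show MemLp.toLp g hgL = g from Lp.toLp_coeFn g hgL]
    calc ‖g‖ ^ 2 ≤ √M₀ ^ 2 := by gcongr
      _ = M₀ := Real.sq_sqrt hM0

end WeakLimit

/-! ### Restriction to smaller domains -/

section Restriction

variable {n : ℕ} {Ω Ω' : Set (EuclideanSpace ℝ (Fin n))}

theorem IsTestFn.mono {φ : EuclideanSpace ℝ (Fin n) → ℝ} (h : Ω' ⊆ Ω) (hφ : IsTestFn Ω' φ) :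
    IsTestFn Ω φ :=
  ⟨hφ.contDiff, hφ.hasCompactSupport, hφ.tsupport_subset.trans h⟩

theorem HasWeakPartial.mono {i : Fin n} {u g : EuclideanSpace ℝ (Fin n) → ℝ} (h : Ω' ⊆ Ω)
    (hu : HasWeakPartial Ω i u g) : HasWeakPartial Ω' i u g where
  locallyIntegrableOn := hu.locallyIntegrableOn.mono_set h
  locallyIntegrableOn_deriv := hu.locallyIntegrableOn_deriv.mono_set h
  integral_eq φ hφ := by
    have := hu.integral_eq φ (hφ.mono h)
    rwa [(hφ.partialD i).setIntegral_mul, hφ.setIntegral_mul, ← ((hφ.mono h).partialD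
      i).setIntegral_mul, ← (hφ.mono h).setIntegral_mul]

theorem HasWeakPartial.congr_ae {i : Fin n} {u u' g : EuclideanSpace ℝ (Fin n) → ℝ}
    (hu : HasWeakPartial Ω i u g) (h : u =ᵐ[volume.restrict Ω] u')
    (hu' : LocallyIntegrableOn u' Ω volume) : HasWeakPartial Ω i u' g where
  locallyIntegrableOn := hu'
  locallyIntegrableOn_deriv := hu.locallyIntegrableOn_deriv
  integral_eq φ hφ := by
    rw [← hu.integral_eq φ hφ]
    refine integral_congr_ae ?_
    filter_upwards [h] with x hx
    rw [hx]

theorem IsDivFree.mono {h : Fin n → EuclideanSpace ℝ (Fin n) → ℝ} (hs : Ω' ⊆ Ω)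
    (hd : IsDivFree Ω h) : IsDivFree Ω' h := by
  intro φ hφ
  rw [← hd φ (hφ.mono hs)]
  have hz : ∀ x ∉ Ω', ∑ i, h i x * DivForm.partialD i φ x = 0 := fun x hx => by
    simp [partialD_eq_zero_of_notMem fun hx' => hx (hφ.tsupport_subset hx')]
  rw [setIntegral_eq_integral_of_forall_compl_eq_zero hz,
    setIntegral_eq_integral_of_forall_compl_eq_zero fun x hx => hz x fun hx' => hx (hs hx')]

theorem MemL2.mono {f : EuclideanSpace ℝ (Fin n) → ℝ} (hs : Ω' ⊆ Ω) (hf : MemL2 Ω f) :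
    MemL2 Ω' f :=
  MemLp.mono_measure (Measure.restrict_mono_set volume hs) hf

theorem IsCoeff.mono {lam L : ℝ} {A : EuclideanSpace ℝ (Fin n) → Matrix (Fin n) (Fin n) ℝ}
    (hs : Ω' ⊆ Ω) (hA : IsCoeff Ω lam L A) : IsCoeff Ω' lam L A :=
  ⟨hA.continuous, fun x hx => hA.coercive x (hs hx), fun x hx => hA.bound x (hs hx),
    fun i j x hx y hy => hA.lipschitz i j x (hs hx) y (hs hy)⟩

theorem setIntegral_sq_mono {f : EuclideanSpace ℝ (Fin n) → ℝ} (hs : Ω' ⊆ Ω) (hf : MemL2 Ω f) :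
    ∫ x in Ω', f x ^ 2 ≤ ∫ x in Ω, f x ^ 2 :=
  setIntegral_mono_set (MemLp.integrable_sq hf) (.of_forall fun _ => sq_nonneg _) hs.eventuallyLE

end Restriction

/-! ### Interior estimates -/

section Interior

variable {n : ℕ}

theorem exists_cutoff (n : ℕ) {r R : ℝ} (hr : 0 < r) (hrR : r < R) :
    ∃ (η : EuclideanSpace ℝ (Fin n) → ℝ) (D : ℝ), ContDiff ℝ ∞ η ∧ HasCompactSupport η ∧
      tsupport η ⊆ closedBall 0 R ∧ (∀ x, |η x| ≤ 1) ∧ (∀ x ∈ ball 0 r, η x = 1) ∧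
      0 ≤ D ∧ ∀ x, ∑ i, partialD i η x ^ 2 ≤ D := by
  let β : ContDiffBump (0 : EuclideanSpace ℝ (Fin n)) := ⟨r, R, hr, hrR⟩
  have hβ : ContDiff ℝ ∞ β := β.contDiff
  have hc : HasCompactSupport fun x => ∑ i, partialD i β x ^ 2 := by
    refine β.hasCompactSupport.mono' fun x hx => ?_
    by_contra hx'
    exact hx (by simp [partialD_eq_zero_of_notMem hx'])
  have hcont : Continuous fun x => ∑ i, partialD i β x ^ 2 := by
    have := fun i => (partialD_contDiff hβ i).continuous
    fun_prop
  obtain ⟨D, hD⟩ := hcont.bounded_above_of_compact_support hc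
  refine ⟨β, D, hβ, β.hasCompactSupport, β.tsupport_eq.subset, fun x => ?_, fun x hx => ?_,
    (norm_nonneg _).trans (hD 0), fun x => (le_abs_self _).trans (hD x)⟩
  · rw [abs_of_nonneg β.nonneg]
    exact β.le_one
  · exact β.one_of_mem_closedBall (ball_subset_closedBall hx)

theorem closedBall_subset_ball_of_mem {r R δ : ℝ} (hδ : δ < (R - r) / 2)
    {x : EuclideanSpace ℝ (Fin n)} (hx : x ∈ closedBall 0 ((r + R) / 2)) :
    closedBall x δ ⊆ ball 0 R := by
  refine closedBall_subset_ball' ?_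
  have := mem_closedBall.mp hx
  linarith

/-- The data of the equation `div (A g + F) = 0` in `Ω` with `g` the weak gradient of `u`, all
functions being square integrable. -/
structure IsSol (Ω : Set (EuclideanSpace ℝ (Fin n)))
    (A : EuclideanSpace ℝ (Fin n) → Matrix (Fin n) (Fin n) ℝ)
    (F g : Fin n → EuclideanSpace ℝ (Fin n) → ℝ) (u : EuclideanSpace ℝ (Fin n) → ℝ) : Prop where
  memL2 : MemL2 Ω u
  memL2_grad : ∀ i, MemL2 Ω (g i)
  memL2_field : ∀ i, MemL2 Ω (F i)
  hasWeakPartial : ∀ i, HasWeakPartial Ω i u (g i)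
  isDivFree : IsDivFree Ω (flux A g F)

theorem IsSol.mono {Ω Ω' : Set (EuclideanSpace ℝ (Fin n))}
    {A : EuclideanSpace ℝ (Fin n) → Matrix (Fin n) (Fin n) ℝ}
    {F g : Fin n → EuclideanSpace ℝ (Fin n) → ℝ} {u : EuclideanSpace ℝ (Fin n) → ℝ}
    (hs : Ω' ⊆ Ω) (h : IsSol Ω A F g u) : IsSol Ω' A F g u :=
  ⟨h.memL2.mono hs, fun i => (h.memL2_grad i).mono hs, fun i => (h.memL2_field i).mono hs,
    fun i => (h.hasWeakPartial i).mono hs, h.isDivFree.mono hs⟩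

/-- `mollified_energy_le` on concentric balls, with a cutoff function of the radii only. -/
theorem exists_mollified_interior_le (n : ℕ) {lam : ℝ} (hlam : 0 < lam) (L : ℝ) {r R : ℝ}
    (hr : 0 < r) (hrR : r < R) :
    ∃ C : ℝ, 0 ≤ C ∧ ∀ (A : EuclideanSpace ℝ (Fin n) → Matrix (Fin n) (Fin n) ℝ)
      (F g : Fin n → EuclideanSpace ℝ (Fin n) → ℝ) (u κ : EuclideanSpace ℝ (Fin n) → ℝ) (δ : ℝ),
      IsCoeff (ball 0 R) lam L A → IsSol (ball 0 R) A F g u → 0 ≤ δ → δ < (R - r) / 2 →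
      ContDiff ℝ ∞ κ → tsupport κ ⊆ closedBall 0 δ → ∀ j,
      ∫ x in ball 0 r, partialD j (conv κ ((ball 0 R).indicator u)) x ^ 2 ≤
        C * ((∫ z, ‖z‖ * |κ z|) ^ 2 * (∑ j, ∫ x in ball 0 R, g j x ^ 2)
          + (∑ i, ∫ x in closedBall 0 ((r + R) / 2), conv κ ((ball 0 R).indicator (F i)) x ^ 2)
          + ∫ x in closedBall 0 ((r + R) / 2), conv κ ((ball 0 R).indicator u) x ^ 2) := by
  obtain ⟨η, D, hη, hc, hsη, hη1, hη2, hD0, hD⟩ :=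
    exists_cutoff n hr (show r < (r + R) / 2 by linarith)
  set c₁ : ℝ := (1 / lam + 1) * (2 * n ^ 2 * L ^ 2) with hc₁
  set c₂ : ℝ := (1 / lam + 1) * 2 with hc₂
  set c₃ : ℝ := (4 * (n ^ 2 * L ^ 2 + 1) / lam + 1) * D with hc₃
  have hc₁0 : 0 ≤ c₁ := by positivity
  have hc₂0 : 0 ≤ c₂ := by positivity
  have hc₃0 : 0 ≤ c₃ := by positivity
  refine ⟨2 / lam * (c₁ + c₂ + c₃), by positivity, ?_⟩
  intro A F g u κ δ hA hsol hδ0 hδ hκ hs j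
  have hκc := hasCompactSupport_of_tsupport_subset_closedBall hs
  have hm : MeasurableSet (ball (0 : EuclideanSpace ℝ (Fin n)) R) := measurableSet_ball
  have hen := mollified_energy_le hA hlam hm hsol.memL2 hsol.memL2_grad hsol.memL2_field
    hsol.hasWeakPartial hsol.isDivFree hδ0 hκ hs hη hc hη1 hD
    (fun x hx => closedBall_subset_ball_of_mem hδ (hsη hx))
  have smooth : ∀ {f : EuclideanSpace ℝ (Fin n) → ℝ}, MemL2 (ball 0 R) f →
      ContDiff ℝ ∞ (conv κ ((ball 0 R).indicator f)) := fun hf =>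
    conv_contDiff hκ hκc ((hf.memLp_indicator hm).locallyIntegrable (by norm_num))
  have hmono : ∀ {f : EuclideanSpace ℝ (Fin n) → ℝ}, MemL2 (ball 0 R) f →
      ∫ x in tsupport η, conv κ ((ball 0 R).indicator f) x ^ 2 ≤
        ∫ x in closedBall 0 ((r + R) / 2), conv κ ((ball 0 R).indicator f) x ^ 2 := fun hf =>
    setIntegral_mono_set
      (((smooth hf).continuous.pow 2).continuousOn.integrableOn_compact (isCompact_closedBall _ _))
      (.of_forall fun x => sq_nonneg _) hsη.eventuallyLE
  set v := conv κ ((ball 0 R).indicator u) with hv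
  have hvs : ContDiff ℝ ∞ v := smooth hsol.memL2
  have cdv := fun i => (partialD_contDiff hvs i).continuous
  have cη := hη.continuous
  have i0 : Integrable (fun x => η x ^ 2 * ∑ i, partialD i v x ^ 2) volume :=
    Continuous.integrable_of_hasCompactSupport (by fun_prop)
      (HasCompactSupport.mul_right (hc.comp_left (g := fun t : ℝ => t ^ 2) (by simp)))
  have hlow : ∫ x in ball 0 r, partialD j v x ^ 2 ≤ ∫ x, η x ^ 2 * ∑ i, partialD i v x ^ 2 := by
    refine le_trans ?_ (setIntegral_le_integral (s := ball 0 r) i0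
      (.of_forall fun x => by positivity))
    refine setIntegral_mono_on ?_ i0.integrableOn measurableSet_ball fun x hx => ?_
    · exact (((cdv j).pow 2).continuousOn.integrableOn_compact
        (isCompact_closedBall 0 r)).mono_set ball_subset_closedBall
    · rw [hη2 x hx, one_pow, one_mul]
      exact Finset.single_le_sum (f := fun i => partialD i v x ^ 2) (fun i _ => sq_nonneg _)
        (Finset.mem_univ j)
  set a := (∫ z, ‖z‖ * |κ z|) ^ 2 * (∑ j, ∫ x in ball 0 R, g j x ^ 2) with ha
  set b := ∑ i, ∫ x in closedBall 0 ((r + R) / 2), conv κ ((ball 0 R).indicator (F i)) x ^ 2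
    with hb
  set c := ∫ x in closedBall 0 ((r + R) / 2), v x ^ 2 with hcdef
  have ha0 : 0 ≤ a := mul_nonneg (sq_nonneg _)
    (Finset.sum_nonneg fun i _ => integral_nonneg fun x => sq_nonneg _)
  have hb0 : 0 ≤ b := Finset.sum_nonneg fun i _ => integral_nonneg fun x => sq_nonneg _
  have hcc0 : 0 ≤ c := integral_nonneg fun x => sq_nonneg _
  have hb' : ∑ i, ∫ x in tsupport η, conv κ ((ball 0 R).indicator (F i)) x ^ 2 ≤ b :=
    Finset.sum_le_sum fun i _ => hmono (hsol.memL2_field i)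
  have hc' : ∫ x in tsupport η, v x ^ 2 ≤ c := hmono hsol.memL2
  have h1 : lam / 2 * ∫ x, η x ^ 2 * ∑ i, partialD i v x ^ 2 ≤ c₁ * a + c₂ * b + c₃ * c := by
    refine hen.trans ?_
    have e1 := mul_le_mul_of_nonneg_left hb' hc₂0
    have e2 := mul_le_mul_of_nonneg_left hc' hc₃0
    rw [hc₁, ha]
    rw [hc₂] at e1 ⊢
    rw [hc₃] at e2 ⊢
    linarith
  have h2 : c₁ * a + c₂ * b + c₃ * c ≤ (c₁ + c₂ + c₃) * (a + b + c) := by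
    have := mul_nonneg hc₁0 hb0
    have := mul_nonneg hc₁0 hcc0
    have := mul_nonneg hc₂0 ha0
    have := mul_nonneg hc₂0 hcc0
    have := mul_nonneg hc₃0 ha0
    have := mul_nonneg hc₃0 hb0
    linarith
  refine hlow.trans ?_
  calc _ = 2 / lam * (lam / 2 * ∫ x, η x ^ 2 * ∑ i, partialD i v x ^ 2) := by field_simp
    _ ≤ 2 / lam * ((c₁ + c₂ + c₃) * (a + b + c)) := by
        refine mul_le_mul_of_nonneg_left (h1.trans h2) (by positivity)
    _ = _ := by ring

theorem IsMollifier.setIntegral_conv_sq_le {δ R : ℝ} {ρ f : EuclideanSpace ℝ (Fin n) → ℝ}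
    (h : IsMollifier δ ρ) (hf : MemL2 (ball 0 R) f) (s : Set (EuclideanSpace ℝ (Fin n))) :
    ∫ x in s, conv ρ ((ball 0 R).indicator f) x ^ 2 ≤ ∫ x in ball 0 R, f x ^ 2 := by
  have h1 := memLp_conv h.contDiff.continuous h.hasCompactSupport
    (hf.memLp_indicator measurableSet_ball)
  rw [h.integral_abs_eq_one, one_pow, one_mul, integral_indicator_sq measurableSet_ball] at h1
  exact (setIntegral_le_integral h1.1.integrable_sq (.of_forall fun x => sq_nonneg _)).trans h1.2

theorem tendsto_setIntegral_conv {δ : ℕ → ℝ} {ρ : ℕ → EuclideanSpace ℝ (Fin n) → ℝ} {r R : ℝ}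
    (hrR : r ≤ R) (hρ : ∀ m, IsMollifier (δ m) (ρ m))
    (hδ : Filter.Tendsto δ Filter.atTop (nhds 0)) {f ψ : EuclideanSpace ℝ (Fin n) → ℝ}
    (hf : MemL2 (ball 0 R) f) (hψ : IsTestFn (ball 0 r) ψ) :
    Filter.Tendsto (fun m => ∫ x in ball 0 r, conv (ρ m) ((ball 0 R).indicator f) x * ψ x)
      Filter.atTop (nhds (∫ x in ball 0 r, f x * ψ x)) := by
  have hfin : IsFiniteMeasure (volume.restrict (ball (0 : EuclideanSpace ℝ (Fin n)) R)) :=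
    ⟨by simpa using measure_ball_lt_top⟩
  have hint : Integrable ((ball 0 R).indicator f) volume :=
    (integrable_indicator_iff measurableSet_ball).mpr (MemLp.integrable (by norm_num) hf)
  have := tendsto_integral_conv_mul hρ hδ hint hψ.contDiff.continuous hψ.hasCompactSupport
  have e : ∫ x in ball 0 r, f x * ψ x = ∫ x, (ball 0 R).indicator f x * ψ x := by
    rw [← hψ.setIntegral_mul]
    refine setIntegral_congr_fun measurableSet_ball fun x hx => ?_
    rw [indicator_of_mem (ball_subset_ball hrR hx)]
  rw [e]
  simpa only [hψ.setIntegral_mul] using this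

theorem memL2_ball_of_continuous {f : EuclideanSpace ℝ (Fin n) → ℝ} (hf : Continuous f) (r : ℝ) :
    MemL2 (ball 0 r) f := by
  refine (memLp_two_iff_integrable_sq hf.aestronglyMeasurable).mpr ?_
  exact ((hf.pow 2).continuousOn.integrableOn_compact
    (isCompact_closedBall 0 r)).mono_set ball_subset_closedBall

/-- Mollifiers whose scales tend to zero and stay below `d`, the first moments of their derivatives
being bounded. -/
theorem exists_mollifiers (n : ℕ) {d : ℝ} (hd : 0 < d) : ∃ (C : ℝ) (δ : ℕ → ℝ)
    (ρ : ℕ → EuclideanSpace ℝ (Fin n) → ℝ), (∀ m, 0 ≤ δ m ∧ δ m < d) ∧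
      Filter.Tendsto δ Filter.atTop (nhds 0) ∧ (∀ m, IsMollifier (δ m) (ρ m)) ∧
      ∀ m k, ∫ z, ‖z‖ * |partialD k (ρ m) z| ≤ C := by
  obtain ⟨C, hC⟩ := exists_isMollifier n
  have hpos : ∀ m : ℕ, 0 < d / 2 * (1 / ((m : ℝ) + 1)) := fun m => by positivity
  choose ρ hρ hρC using fun m : ℕ => hC _ (hpos m)
  refine ⟨C, fun m => d / 2 * (1 / ((m : ℝ) + 1)), ρ, fun m => ⟨(hpos m).le, ?_⟩, ?_, hρ, hρC⟩
  · have : 1 / ((m : ℝ) + 1) ≤ 1 := by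
      rw [div_le_one (by positivity)]
      linarith [Nat.cast_nonneg (α := ℝ) m]
    nlinarith
  · simpa using tendsto_one_div_add_atTop_nhds_zero_nat.const_mul (d / 2)

/-- Caccioppoli's inequality for weak solutions, from `exists_mollified_interior_le` with the
kernels `ρ_δ`: their first moment, the factor of `‖∇u‖`, tends to zero. -/
theorem exists_gradient_le (n : ℕ) {lam : ℝ} (hlam : 0 < lam) (L : ℝ) {r R : ℝ}
    (hr : 0 < r) (hrR : r < R) :
    ∃ C : ℝ, 0 ≤ C ∧ ∀ (A : EuclideanSpace ℝ (Fin n) → Matrix (Fin n) (Fin n) ℝ)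
      (F g : Fin n → EuclideanSpace ℝ (Fin n) → ℝ) (u : EuclideanSpace ℝ (Fin n) → ℝ),
      IsCoeff (ball 0 R) lam L A → IsSol (ball 0 R) A F g u → ∀ j,
      ∫ x in ball 0 r, g j x ^ 2 ≤
        C * ((∑ i, ∫ x in ball 0 R, F i x ^ 2) + ∫ x in ball 0 R, u x ^ 2) := by
  obtain ⟨C, hC0, hC⟩ := exists_mollified_interior_le n hlam L hr hrR
  obtain ⟨-, δ, ρ, hδ, hδ0, hρ, -⟩ := exists_mollifiers n (d := (R - r) / 2) (by linarith)
  refine ⟨C, hC0, fun A F g u hA hsol j => ?_⟩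
  set a := ∑ j, ∫ x in ball 0 R, g j x ^ 2 with ha
  have ha0 : 0 ≤ a := Finset.sum_nonneg fun i _ => integral_nonneg fun x => sq_nonneg _
  have hsub : ball (0 : EuclideanSpace ℝ (Fin n)) r ⊆ ball 0 R := ball_subset_ball hrR.le
  have hM : Filter.Tendsto (fun m => C * (δ m ^ 2 * a + (∑ i, ∫ x in ball 0 R, F i x ^ 2)
      + ∫ x in ball 0 R, u x ^ 2)) Filter.atTop
      (nhds (C * ((∑ i, ∫ x in ball 0 R, F i x ^ 2) + ∫ x in ball 0 R, u x ^ 2))) := by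
    have := ((((hδ0.pow 2).mul_const a).add_const (∑ i, ∫ x in ball 0 R, F i x ^ 2)).add_const
      (∫ x in ball 0 R, u x ^ 2)).const_mul C
    simpa using this
  have hsm : ∀ m, ContDiff ℝ ∞ (conv (ρ m) ((ball 0 R).indicator u)) := fun m =>
    conv_contDiff (hρ m).contDiff (hρ m).hasCompactSupport
      ((hsol.memL2.memLp_indicator measurableSet_ball).locallyIntegrable (by norm_num))
  have hwM : ∀ m, ∫ x in ball 0 r, partialD j (conv (ρ m) ((ball 0 R).indicator u)) x ^ 2 ≤
      C * (δ m ^ 2 * a + (∑ i, ∫ x in ball 0 R, F i x ^ 2) + ∫ x in ball 0 R, u x ^ 2) := by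
    intro m
    refine (hC A F g u (ρ m) (δ m) hA hsol (hδ m).1 (hδ m).2 (hρ m).contDiff
      (hρ m).tsupport_subset j).trans (mul_le_mul_of_nonneg_left ?_ hC0)
    refine add_le_add (add_le_add (mul_le_mul_of_nonneg_right ?_ ha0) ?_) ?_
    · exact pow_le_pow_left₀ (integral_nonneg fun z => by positivity)
        (hρ m).integral_norm_mul_le 2
    · exact Finset.sum_le_sum fun i _ => (hρ m).setIntegral_conv_sq_le (hsol.memL2_field i) _
    · exact (hρ m).setIntegral_conv_sq_le hsol.memL2 _
  obtain ⟨g', hg', hgL, hgM⟩ := exists_hasWeakPartial_of_tendsto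
    (hsol.memL2.mono hsub).locallyIntegrableOn j hsm
    (fun m => memL2_ball_of_continuous (partialD_contDiff (hsm m) j).continuous r)
    hwM hM (fun ψ hψ => tendsto_setIntegral_conv hrR.le hρ hδ0 hsol.memL2 hψ)
  refine le_trans (le_of_eq ?_) hgM
  refine integral_congr_ae ?_
  filter_upwards [HasWeakPartial.ae_eq isOpen_ball ((hsol.hasWeakPartial j).mono hsub) hg']
    with x hx
  rw [hx]

/-- Interior estimate of the second derivatives by the first ones, from
`exists_mollified_interior_le` with the kernels `∂_k ρ_δ`. -/
theorem exists_hessian_le (n : ℕ) {lam : ℝ} (hlam : 0 < lam) (L : ℝ) {r R : ℝ}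
    (hr : 0 < r) (hrR : r < R) :
    ∃ C : ℝ, 0 ≤ C ∧ ∀ (A : EuclideanSpace ℝ (Fin n) → Matrix (Fin n) (Fin n) ℝ)
      (F g : Fin n → EuclideanSpace ℝ (Fin n) → ℝ) (u : EuclideanSpace ℝ (Fin n) → ℝ)
      (F' : Fin n → Fin n → EuclideanSpace ℝ (Fin n) → ℝ),
      IsCoeff (ball 0 R) lam L A → IsSol (ball 0 R) A F g u →
      (∀ i k, HasWeakPartial (ball 0 R) k (F i) (F' i k)) →
      (∀ i k, MemL2 (ball 0 R) (F' i k)) → ∀ k j,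
      ∃ G, HasWeakPartial (ball 0 r) j (g k) G ∧ MemL2 (ball 0 r) G ∧ ∫ x in ball 0 r, G x ^ 2 ≤
        C * ((∑ i, ∫ x in ball 0 R, g i x ^ 2) + ∑ i, ∫ x in ball 0 R, F' i k x ^ 2) := by
  obtain ⟨C, hC0, hC⟩ := exists_mollified_interior_le n hlam L hr hrR
  obtain ⟨C', δ, ρ, hδ, hδ0, hρ, hρC⟩ := exists_mollifiers n (d := (R - r) / 2) (by linarith)
  refine ⟨C * (C' ^ 2 + 1), by positivity, fun A F g u F' hA hsol hF' hF'2 k j => ?_⟩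
  have hsub : ball (0 : EuclideanSpace ℝ (Fin n)) r ⊆ ball 0 R := ball_subset_ball hrR.le
  have hmeas : MeasurableSet (ball (0 : EuclideanSpace ℝ (Fin n)) R) := measurableSet_ball
  set w : ℕ → EuclideanSpace ℝ (Fin n) → ℝ :=
    fun m => conv (partialD k (ρ m)) ((ball 0 R).indicator u) with hw
  have hws : ∀ m, ContDiff ℝ ∞ (w m) := fun m =>
    conv_contDiff (partialD_contDiff (hρ m).contDiff k)
      (hasCompactSupport_partialD (hρ m).hasCompactSupport k)
      ((hsol.memL2.memLp_indicator hmeas).locallyIntegrable (by norm_num))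
  have hpart : ∀ m {f f' : EuclideanSpace ℝ (Fin n) → ℝ}, HasWeakPartial (ball 0 R) k f f' →
      ∀ x ∈ closedBall 0 ((r + R) / 2), conv (partialD k (ρ m)) ((ball 0 R).indicator f) x =
        conv (ρ m) ((ball 0 R).indicator f') x := fun m f f' hf x hx =>
    hf.conv_partialD_eq hmeas (hρ m).contDiff (hρ m).tsupport_subset
      (closedBall_subset_ball_of_mem (hδ m).2 hx)
  have hpart2 : ∀ m {f f' : EuclideanSpace ℝ (Fin n) → ℝ}, HasWeakPartial (ball 0 R) k f f' →
      MemL2 (ball 0 R) f' → ∫ x in closedBall 0 ((r + R) / 2),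
        conv (partialD k (ρ m)) ((ball 0 R).indicator f) x ^ 2 ≤ ∫ x in ball 0 R, f' x ^ 2 := by
    intro m f f' hf hf'
    refine le_trans (le_of_eq ?_) ((hρ m).setIntegral_conv_sq_le hf' (closedBall 0 ((r + R) / 2)))
    refine setIntegral_congr_fun measurableSet_closedBall fun x hx => ?_
    simp only [hpart m hf x hx]
  have hsmall : ball (0 : EuclideanSpace ℝ (Fin n)) r ⊆ closedBall 0 ((r + R) / 2) :=
    ball_subset_closedBall.trans (closedBall_subset_closedBall (by linarith))
  set a := ∑ j, ∫ x in ball 0 R, g j x ^ 2 with ha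
  have ha0 : 0 ≤ a := Finset.sum_nonneg fun i _ => integral_nonneg fun x => sq_nonneg _
  set b := ∑ i, ∫ x in ball 0 R, F' i k x ^ 2 with hb
  have hb0 : 0 ≤ b := Finset.sum_nonneg fun i _ => integral_nonneg fun x => sq_nonneg _
  refine exists_hasWeakPartial_of_tendsto
    ((hsol.memL2_grad k).mono hsub).locallyIntegrableOn j hws
    (fun m => memL2_ball_of_continuous (partialD_contDiff (hws m) j).continuous r)
    (fun m => ?_) tendsto_const_nhds (fun ψ hψ => ?_)
  · refine (hC A F g u _ (δ m) hA hsol (hδ m).1 (hδ m).2 (partialD_contDiff (hρ m).contDiff k)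
      ((tsupport_partialD_subset _ k).trans (hρ m).tsupport_subset) j).trans ?_
    rw [mul_assoc]
    refine mul_le_mul_of_nonneg_left ?_ hC0
    have h1 : (∫ z, ‖z‖ * |partialD k (ρ m) z|) ^ 2 ≤ C' ^ 2 :=
      pow_le_pow_left₀ (integral_nonneg fun z => by positivity) (hρC m k) 2
    have h2 : ∑ i, ∫ x in closedBall 0 ((r + R) / 2),
        conv (partialD k (ρ m)) ((ball 0 R).indicator (F i)) x ^ 2 ≤ b :=
      Finset.sum_le_sum fun i _ => hpart2 m (hF' i k) (hF'2 i k)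
    have h3 := hpart2 m (hsol.hasWeakPartial k) (hsol.memL2_grad k)
    have h4 : ∫ x in ball 0 R, g k x ^ 2 ≤ a :=
      Finset.single_le_sum (f := fun i => ∫ x in ball 0 R, g i x ^ 2)
        (fun i _ => integral_nonneg fun x => sq_nonneg _) (Finset.mem_univ k)
    have h5 := mul_le_mul_of_nonneg_right h1 ha0
    have h6 : 0 ≤ C' ^ 2 * b := by positivity
    linarith
  · refine (tendsto_setIntegral_conv hrR.le hρ hδ0 (hsol.memL2_grad k) hψ).congr fun m => ?_
    refine setIntegral_congr_fun measurableSet_ball fun x hx => ?_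
    simp only [hw, hpart m (hsol.hasWeakPartial k) x (hsmall hx)]

end Interior

/-! ### Sobolev norms as integrals -/

section Norms

variable {n : ℕ} {Ω : Set (EuclideanSpace ℝ (Fin n))}

theorem HasWeakPartial.weakPartial_ae_eq (hΩ : IsOpen Ω) {i : Fin n}
    {u g : EuclideanSpace ℝ (Fin n) → ℝ} (h : HasWeakPartial Ω i u g) :
    weakPartial Ω i u =ᵐ[volume.restrict Ω] g :=
  (hasWeakPartial_weakPartial ⟨g, h⟩).ae_eq hΩ h

theorem MemH1.hasWeakPartial {u : EuclideanSpace ℝ (Fin n) → ℝ} (h : MemH1 Ω u) (i : Fin n) :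
    HasWeakPartial Ω i u (weakPartial Ω i u) :=
  hasWeakPartial_weakPartial ((h.2 i).imp fun _ hg => hg.1)

theorem MemH1.memL2_weakPartial (hΩ : IsOpen Ω) {u : EuclideanSpace ℝ (Fin n) → ℝ}
    (h : MemH1 Ω u) (i : Fin n) : MemL2 Ω (weakPartial Ω i u) := by
  obtain ⟨g, hg, hgL⟩ := h.2 i
  exact MemLp.ae_eq (hg.weakPartial_ae_eq hΩ).symm hgL

theorem normL2_sq {f : EuclideanSpace ℝ (Fin n) → ℝ} (hf : MemL2 Ω f) :
    normL2 Ω f ^ 2 = ∫ x in Ω, f x ^ 2 := by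
  rw [← norm_toLp_sq hf, normL2, ← Lp.norm_toLp f hf]

theorem normL2_congr_ae {f g : EuclideanSpace ℝ (Fin n) → ℝ}
    (h : f =ᵐ[volume.restrict Ω] g) : normL2 Ω f = normL2 Ω g := by
  rw [normL2, normL2, eLpNorm_congr_ae h]

theorem fieldNormH1_sq (hΩ : IsOpen Ω) {F : EuclideanSpace ℝ (Fin n) → Fin n → ℝ}
    (hF : FieldMemH1 Ω F) :
    fieldNormH1 Ω F ^ 2 = ∑ i, ((∫ x in Ω, F x i ^ 2)
      + ∑ k, ∫ x in Ω, weakPartial Ω k (fun y => F y i) x ^ 2) := by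
  rw [fieldNormH1, Real.sq_sqrt (Finset.sum_nonneg fun i _ => sq_nonneg _)]
  refine Finset.sum_congr rfl fun i _ => ?_
  rw [normH1, Real.sq_sqrt (add_nonneg (sq_nonneg _) (Finset.sum_nonneg fun i _ => sq_nonneg _)),
    normL2_sq (hF i).1]
  simp_rw [normL2_sq ((hF i).memL2_weakPartial hΩ _)]

end Norms

/-! ### Coefficients and weak solutions -/

section Coefficients

variable {n : ℕ} {Ω : Set (EuclideanSpace ℝ (Fin n))}

theorem abs_le_of_eNormC01_le {a : EuclideanSpace ℝ (Fin n) → ℝ} {L : ℝ}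
    (h : eNormC01 Ω a ≤ ENNReal.ofReal L) {x : EuclideanSpace ℝ (Fin n)} (hx : x ∈ Ω) :
    |a x| ≤ max L 0 := by
  have h1 : ‖a x‖ₑ ≤ ENNReal.ofReal L :=
    ((le_iSup₂ (f := fun x (_ : x ∈ Ω) => ‖a x‖ₑ) x hx).trans le_self_add).trans h
  have h2 := ENNReal.toReal_mono ENNReal.ofReal_ne_top h1
  rwa [ENNReal.toReal_ofReal', toReal_enorm] at h2

theorem lipschitzOnWith_of_eNormC01_le {a : EuclideanSpace ℝ (Fin n) → ℝ} {L : ℝ}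
    (h : eNormC01 Ω a ≤ ENNReal.ofReal L) : LipschitzOnWith L.toNNReal a Ω := by
  intro x hx y hy
  rcases eq_or_ne x y with rfl | hxy
  · simp
  have h1 : edist (a x) (a y) / edist x y ≤ ENNReal.ofReal L := by
    refine le_trans ?_ (le_add_self.trans h)
    refine le_iSup₂_of_le x hx (le_iSup₂_of_le y hy (le_iSup_of_le hxy le_rfl))
  exact (ENNReal.div_le_iff (by simpa using hxy) (edist_ne_top x y)).mp h1

/-- A uniformly elliptic Lipschitz matrix field agrees in `Ω` with one whose entries are continuous
on `ℝⁿ`. The constant is `max L 0` because `ENNReal.ofReal` truncates at `0`. -/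
theorem exists_isCoeff {A : EuclideanSpace ℝ (Fin n) → Matrix (Fin n) (Fin n) ℝ} {lam Lam L : ℝ}
    (hell : UniformlyElliptic Ω lam Lam A) (hA : matrixENormC01 Ω A ≤ ENNReal.ofReal L) :
    ∃ A', IsCoeff Ω lam (max L 0) A' ∧ ∀ x ∈ Ω, A' x = A x := by
  have h : ∀ i j, eNormC01 Ω (fun x => A x i j) ≤ ENNReal.ofReal L := fun i j =>
    (le_iSup₂ (f := fun i j => eNormC01 Ω (fun x => A x i j)) i j).trans hA
  choose a ha haA using fun i j => (lipschitzOnWith_of_eNormC01_le (h i j)).extend_real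
  have heq : ∀ x ∈ Ω, (Matrix.of fun i j => a i j x) = A x := fun x hx => by
    ext i j
    exact (haA i j hx).symm
  refine ⟨fun x => Matrix.of fun i j => a i j x, ⟨fun i j => (ha i j).continuous, ?_, ?_, ?_⟩,
    heq⟩
  · intro x hx ξ
    rw [heq x hx]
    exact (hell x hx ξ).1
  · intro x hx i j
    rw [heq x hx]
    exact abs_le_of_eNormC01_le (h i j) hx
  · intro i j x _ y _
    have := (ha i j).dist_le_mul y x
    rwa [Real.dist_eq, dist_comm, dist_eq_norm, Real.coe_toNNReal'] at this

theorem IsWeakSolution.isSol (hΩ : IsOpen Ω)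
    {A A' : EuclideanSpace ℝ (Fin n) → Matrix (Fin n) (Fin n) ℝ}
    {F : EuclideanSpace ℝ (Fin n) → Fin n → ℝ} {u : EuclideanSpace ℝ (Fin n) → ℝ} {lam L : ℝ}
    (hA' : IsCoeff Ω lam L A') (hAA' : ∀ x ∈ Ω, A' x = A x) (hF : FieldMemH1 Ω F)
    (h : IsWeakSolution Ω A F u) :
    IsSol Ω A' (fun i x => F x i) (fun i => weakPartial Ω i u) u := by
  have hg := h.memH1.memL2_weakPartial hΩ
  refine ⟨h.memH1.1, hg, fun i => (hF i).1, h.memH1.hasWeakPartial, fun φ hφ => ?_⟩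
  have i1 : ∀ i, IntegrableOn (fun x => (∑ j, A' x i j * weakPartial Ω j u x) * partialD i φ x) Ω
      volume := fun i =>
    (hφ.partialD i).integrable_mul (MemL2.locallyIntegrableOn
      (memLp_finsetSum _ fun j _ => hA'.memL2_mul hΩ.measurableSet i j (hg j)))
  have i2 : ∀ i, IntegrableOn (fun x => F x i * partialD i φ x) Ω volume := fun i =>
    (hφ.partialD i).integrable_mul (hF i).1.locallyIntegrableOn
  have h1 := h.integral_eq φ hφ
  have h2 : ∫ x in Ω, (A x *ᵥ fun i => weakPartial Ω i u x) ⬝ᵥ (fun i => partialD i φ x) =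
      ∫ x in Ω, ∑ i, (∑ j, A' x i j * weakPartial Ω j u x) * partialD i φ x := by
    refine setIntegral_congr_fun hΩ.measurableSet fun x hx => ?_
    simp only [dotProduct, Matrix.mulVec, hAA' x hx]
  rw [h2] at h1
  simp only [dotProduct] at h1
  simp_rw [flux, add_mul, Finset.sum_add_distrib]
  rw [integral_add (integrable_finsetSum _ fun i _ => i1 i)
    (integrable_finsetSum _ fun i _ => i2 i), h1, neg_add_cancel]

end Coefficients

end DivForm

theorem mainTheorem10 (n : ℕ) (hn : 2 ≤ n) (lam Lam L : ℝ) (hlam : 0 < lam)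
    (hLam : lam ≤ Lam) :
    ∃ C : ℝ, 0 < C ∧
      ∀ (A : EuclideanSpace ℝ (Fin n) → Matrix (Fin n) (Fin n) ℝ)
        (F : EuclideanSpace ℝ (Fin n) → Fin n → ℝ) (u : EuclideanSpace ℝ (Fin n) → ℝ),
        UniformlyElliptic (Metric.ball 0 1) lam Lam A →
        matrixENormC01 (Metric.ball 0 1) A ≤ ENNReal.ofReal L →
        FieldMemH1 (Metric.ball 0 1) F →
        IsWeakSolution (Metric.ball 0 1) A F u →
        MemH2 (Metric.ball 0 (1 / 2)) u ∧
          normH2 (Metric.ball 0 (1 / 2)) u ≤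
            C * (normL2 (Metric.ball 0 1) u + fieldNormH1 (Metric.ball 0 1) F) := by
  -- The intermediate radius `3 / 4` keeps `∇u` out of the right-hand side: the second derivatives on
  -- the ball of radius `1 / 2` are bounded by `∇u` on that of radius `3 / 4`, and this by `u`.
  obtain ⟨C₁, hC₁, h₁⟩ := exists_gradient_le n hlam (max L 0) (r := 3 / 4) (R := 1)
    (by norm_num) (by norm_num)
  obtain ⟨C₂, hC₂, h₂⟩ := exists_hessian_le n hlam (max L 0) (r := 1 / 2) (R := 3 / 4)
    (by norm_num) (by norm_num)
  set K : ℝ := 1 + n * C₁ + n * (n * (C₂ * (n * C₁ + 1))) with hK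
  have hK0 : 0 < K := by positivity
  refine ⟨√K, Real.sqrt_pos.mpr hK0, fun A F u hell hAL hF hu => ?_⟩
  have hs : ball (0 : EuclideanSpace ℝ (Fin n)) (1 / 2) ⊆ ball 0 (3 / 4) :=
    ball_subset_ball (by norm_num)
  have hs' : ball (0 : EuclideanSpace ℝ (Fin n)) (3 / 4) ⊆ ball 0 1 :=
    ball_subset_ball (by norm_num)
  obtain ⟨A', hA', hAA'⟩ := exists_isCoeff hell hAL
  have hsol := hu.isSol isOpen_ball hA' hAA' hF
  set g : Fin n → EuclideanSpace ℝ (Fin n) → ℝ := fun i => weakPartial (ball 0 1) i u with hg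
  set F' : Fin n → Fin n → EuclideanSpace ℝ (Fin n) → ℝ :=
    fun i k => weakPartial (ball 0 1) k (fun x => F x i) with hF'
  have hFp : ∀ i k, HasWeakPartial (ball 0 1) k (fun x => F x i) (F' i k) := fun i k =>
    (hF i).hasWeakPartial k
  have hF2 : ∀ i k, MemL2 (ball 0 1) (F' i k) := fun i k => (hF i).memL2_weakPartial isOpen_ball k
  have hgrad := h₁ A' _ g u hA' hsol
  choose G hG hG2 hGle using h₂ A' _ g u F' (hA'.mono hs') (hsol.mono hs')
    (fun i k => (hFp i k).mono hs') (fun i k => (hF2 i k).mono hs')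
  have hug : ∀ i, HasWeakPartial (ball 0 (1 / 2)) i u (g i) := fun i =>
    (hsol.hasWeakPartial i).mono (hs.trans hs')
  have hg2 : ∀ i, MemL2 (ball 0 (1 / 2)) (g i) := fun i =>
    (hsol.memL2_grad i).mono (hs.trans hs')
  have hu2 : MemL2 (ball 0 (1 / 2)) u := hsol.memL2.mono (hs.trans hs')
  refine ⟨⟨hu2, fun i => ⟨g i, hug i, hg2 i, fun j => ⟨G i j, hG i j, hG2 i j⟩⟩⟩, ?_⟩
  set U := normL2 (ball 0 1) u with hU
  set Φ := fieldNormH1 (ball 0 1) F with hΦ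
  have hU0 : 0 ≤ U := ENNReal.toReal_nonneg
  have hΦ0 : 0 ≤ Φ := Real.sqrt_nonneg _
  have hUsq : U ^ 2 = ∫ x in ball 0 1, u x ^ 2 := normL2_sq hsol.memL2
  have hΦsq := fieldNormH1_sq isOpen_ball hF
  rw [← hΦ, Finset.sum_add_distrib] at hΦsq
  have hFΦ : ∑ i, ∫ x in ball 0 1, F x i ^ 2 ≤ Φ ^ 2 := by
    rw [hΦsq]
    exact le_add_of_nonneg_right (Finset.sum_nonneg fun i _ => Finset.sum_nonneg fun k _ =>
      integral_nonneg fun x => sq_nonneg _)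
  have hF'Φ : ∀ k, ∑ i, ∫ x in ball 0 (3 / 4), F' i k x ^ 2 ≤ Φ ^ 2 := by
    intro k
    rw [hΦsq]
    refine le_trans (Finset.sum_le_sum fun i _ => ?_) (le_add_of_nonneg_left
      (Finset.sum_nonneg fun i _ => integral_nonneg fun x => sq_nonneg _))
    exact (setIntegral_sq_mono hs' (hF2 i k)).trans (Finset.single_le_sum
      (f := fun k => ∫ x in ball 0 1, F' i k x ^ 2)
      (fun k _ => integral_nonneg fun x => sq_nonneg _) (Finset.mem_univ k))
  set S := Φ ^ 2 + U ^ 2 with hS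
  have b0 : normL2 (ball 0 (1 / 2)) u ^ 2 ≤ S := by
    rw [normL2_sq hu2, hS, hUsq]
    exact (setIntegral_sq_mono (hs.trans hs') hsol.memL2).trans
      (le_add_of_nonneg_left (sq_nonneg _))
  have b1 : ∀ i, ∫ x in ball 0 (3 / 4), g i x ^ 2 ≤ C₁ * S := by
    intro i
    refine (hgrad i).trans (mul_le_mul_of_nonneg_left ?_ hC₁)
    rw [hS, hUsq]
    exact add_le_add hFΦ le_rfl
  have b1' : ∀ i, normL2 (ball 0 (1 / 2)) (weakPartial (ball 0 (1 / 2)) i u) ^ 2 ≤ C₁ * S := by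
    intro i
    rw [normL2_congr_ae ((hug i).weakPartial_ae_eq isOpen_ball), normL2_sq (hg2 i)]
    exact (setIntegral_sq_mono hs ((hsol.memL2_grad i).mono hs')).trans (b1 i)
  have b2 : ∀ i j, normL2 (ball 0 (1 / 2)) (weakPartial (ball 0 (1 / 2)) j
      (weakPartial (ball 0 (1 / 2)) i u)) ^ 2 ≤ C₂ * (n * C₁ + 1) * S := by
    intro i j
    -- `normH2` differentiates the chosen representative `weakPartial (ball 0 (1 / 2)) i u`.
    have hGw := (hG i j).congr_ae ((hug i).weakPartial_ae_eq isOpen_ball).symm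
      (hasWeakPartial_weakPartial ⟨_, hug i⟩).locallyIntegrableOn_deriv
    rw [normL2_congr_ae (hGw.weakPartial_ae_eq isOpen_ball), normL2_sq (hG2 i j), mul_assoc]
    refine (hGle i j).trans (mul_le_mul_of_nonneg_left ?_ hC₂)
    have e1 : ∑ i, ∫ x in ball 0 (3 / 4), g i x ^ 2 ≤ n * (C₁ * S) := by
      refine (Finset.sum_le_sum fun i _ => b1 i).trans (le_of_eq ?_)
      simp
    have e2 : Φ ^ 2 ≤ S := le_add_of_nonneg_right (sq_nonneg _)
    have e3 := hF'Φ i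
    linarith
  have htot : normL2 (ball 0 (1 / 2)) u ^ 2
      + ∑ i, normL2 (ball 0 (1 / 2)) (weakPartial (ball 0 (1 / 2)) i u) ^ 2
      + ∑ i, ∑ j, normL2 (ball 0 (1 / 2)) (weakPartial (ball 0 (1 / 2)) j
        (weakPartial (ball 0 (1 / 2)) i u)) ^ 2 ≤ K * S := by
    refine (add_le_add (add_le_add b0 (Finset.sum_le_sum fun i _ => b1' i))
      (Finset.sum_le_sum fun i _ => Finset.sum_le_sum fun j _ => b2 i j)).trans (le_of_eq ?_)
    simp only [Finset.sum_const, Finset.card_univ, Fintype.card_fin, nsmul_eq_mul, hK]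
    ring
  rw [normH2]
  refine Real.sqrt_le_iff.mpr ⟨by positivity, htot.trans ?_⟩
  rw [mul_pow, Real.sq_sqrt hK0.le]
  refine mul_le_mul_of_nonneg_left ?_ hK0.le
  nlinarith [mul_nonneg hU0 hΦ0]
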